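/- For $x,y\in(-1,1)$ with $x\neq y$ let $$G(x,y)=\frac1\pi\operatorname{argsinh}\sqrt{\frac{(1-x^2)(1-y^2)}{(x-y)^2}},$$ let $G(x,y)=0$ if $x\notin(-1,1)$ or $y\notin(-1,1)$, and set $$g(x,z)=\tfrac12\big[(z-x)\,G(x,z)+(z+x)\,G(x,-z)\big],$$ where a product $(z\mp x)G(x,\pm z)$ is read as $0$ when $z=\pm x$. For an integrable function $u$ on $\mathbb R$ let $I(u)=-(-\Delta)^{1/2}u$ be the tempered distribution with Fourier transform $-|k|\,\mathcal F u(k)$, where $\mathcal F u(k)=\int_{\mathbb R}u(x)e^{-ixk}\,dx$. **Proposition.** Let $a>-\frac32$. There is a constant $C>0$, depending only on $a$, such that the following holds for every measurable function $f\colon(-1,1)\to\mathbb R$ and every constant $C_f$ with $$|f(z)|\le C_f(1-z^2)^a\qquad\text{for all } z\in(-1,1).$$ The function $$U(x)=\begin{cases}\displaystyle\int_{-1}^1 g(x,z)f(z)\,dz & x\in(-1,1),\\ 0 & x\notin(-1,1)\end{cases}$$ is well defined (the integral converges absolutely), is continuous on $\mathbb R$, is $C^1$ in $(-1,1)$, and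 satisfies $$|U(x)|\le C\,C_f\sqrt{1-x^2}\qquad\text{for all } x\in(-1,1).$$ Furthermore, if $f$ is odd, then $U'$ is an integrable function on $\mathbb R$, which is also the derivative of $U$ in the sense of distributions on $\mathbb R$, and $$I(U)'=I(U')=f\qquad\text{in }\mathcal D'(-1,1).$$ -/

import Mathlib

open MeasureTheory Set TopologicalSpace
open scoped Distributions SchwartzMap FourierTransform LineDeriv ContDiff

noncomputable section

namespace HydraulicFracture

/-! ### The Green functions -/

/-- The Green function of `(-Δ)^{1/2}` on `(-1,1)` with zero exterior condition:
`π⁻¹ argsinh (√r₀(x,y))` with `r₀(x,y) = (1-x²)(1-y²)/(x-y)²` for `x, y ∈ (-1,1)`, and `0`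
otherwise. (On the diagonal, where it is infinite, the formula returns `0`.) -/
def greenG (x y : ℝ) : ℝ :=
  open scoped Classical in
  if x ∈ Ioo (-1 : ℝ) 1 ∧ y ∈ Ioo (-1 : ℝ) 1 then
    Real.pi⁻¹ * Real.arsinh (√((1 - x ^ 2) * (1 - y ^ 2) / (x - y) ^ 2))
  else 0

/-- The Green function `g(x,z) = ½ [(z-x) G(x,z) + (z+x) G(x,-z)]`. -/
def greeng (x z : ℝ) : ℝ :=
  1 / 2 * ((z - x) * greenG x z + (z + x) * greenG x (-z))

/-- `U(x) = ∫_{-1}^1 g(x,z) f(z) dz` for `x ∈ (-1,1)`, and `U(x) = 0` for `x ∉ (-1,1)`. -/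
def potential (f : ℝ → ℝ) (x : ℝ) : ℝ :=
  open scoped Classical in
  if x ∈ Ioo (-1 : ℝ) 1 then ∫ z in Ioo (-1 : ℝ) 1, greeng x z * f z else 0

/-! ### Distributions -/

/-- The interval `(-1,1)` as an open subset of `ℝ`. -/
def interval : Opens ℝ := ⟨Ioo (-1 : ℝ) 1, isOpen_Ioo⟩

/-- The distribution `φ ↦ ∫ φ f` on `Ω` given by a function `f` that is locally integrable on `Ω`. -/
def ofFunction (Ω : Opens ℝ) (f : ℝ → ℝ) : 𝓓'(Ω, ℂ) :=
  ContinuousLinearMap.toUniformConvergenceCLM _ _ _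
    (TestFunction.integralAgainstBilinCLM (𝕜 := ℝ) (ContinuousLinearMap.lsmul ℝ ℝ) volume
      (fun x => (f x : ℂ)))

/-- Real test functions on `Ω` as (complex-valued) Schwartz functions on `ℝ`: the continuous
inclusion `𝓓(Ω) → 𝓢(ℝ)`. -/
def testToSchwartz (Ω : Opens ℝ) : 𝓓(Ω, ℝ) →L[ℝ] 𝓢(ℝ, ℂ) :=
  let incl (φ : 𝓓(Ω, ℂ)) : 𝓢(ℝ, ℂ) := φ.hasCompactSupport.toSchwartzMap φ.contDiff
  TestFunction.mkCLM ℝ incl (fun _ _ => rfl) (fun _ _ => rfl)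
      (by
        intro K hK
        let L : 𝓓_{K}(ℝ, ℂ) →ₗ[ℝ] 𝓢(ℝ, ℂ) :=
          { toFun := fun φ => incl (TestFunction.ofSupportedIn hK φ)
            map_add' := fun _ _ => rfl
            map_smul' := fun _ _ => rfl }
        change Continuous L
        refine WithSeminorms.continuous_of_isBounded
          (ContDiffMapSupportedIn.withSeminorms ℝ ℝ ℂ ⊤ K) (schwartz_withSeminorms ℝ ℝ ℂ) L
          (Seminorm.IsBounded.of_real fun m => ?_)
        obtain ⟨R, hR⟩ := K.isCompact.isBounded.exists_norm_le
        refine ⟨{m.2}, |R| ^ m.1, fun φ => ?_⟩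
        simp only [Finset.sup_singleton]
        refine SchwartzMap.seminorm_le_bound ℝ m.1 m.2 _
          (mul_nonneg (by positivity) (apply_nonneg _ _)) fun x => ?_
        change ‖x‖ ^ m.1 * ‖iteratedFDeriv ℝ m.2 (φ : ℝ → ℂ) x‖ ≤ _
        by_cases hx : x ∈ K
        · refine mul_le_mul (pow_le_pow_left₀ (norm_nonneg x) ((hR x hx).trans (le_abs_self R)) _)
            (ContDiffMapSupportedIn.norm_iteratedFDeriv_apply_le_seminorm_top ℝ)
            (norm_nonneg _) (by positivity)
        · rw [φ.iteratedFDeriv_zero_on_compl hx]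
          simpa using mul_nonneg (by positivity) (apply_nonneg _ _))
    ∘L TestFunction.postcompCLM (𝕜 := ℝ) Complex.ofRealCLM

/-- The restriction to `Ω` of a tempered distribution on `ℝ`. -/
def restrictTo (Ω : Opens ℝ) (T : 𝓢'(ℝ, ℂ)) : 𝓓'(Ω, ℂ) :=
  ContinuousLinearMap.toUniformConvergenceCLM _ _ _
    ((ContinuousLinearMap.restrictScalars ℝ (show 𝓢(ℝ, ℂ) →L[ℂ] ℂ from T)) ∘L testToSchwartz Ω)

/-! ### The operator `I = -(-Δ)^{1/2}` -/

/-- The function `k ↦ -|k| û(k)`, in the normalization `𝓕 u (ξ) = ∫ u(x) exp(-2πixξ) dx`,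
where `k = 2πξ`. -/
def symbolTimesFourier (u : ℝ → ℝ) (ξ : ℝ) : ℂ :=
  -((2 * Real.pi * |ξ| : ℝ) : ℂ) * 𝓕 (fun x => (u x : ℂ)) ξ

lemma aestronglyMeasurable_symbolTimesFourier (u : ℝ → ℝ) :
    AEStronglyMeasurable (symbolTimesFourier u) := by
  have hc : Continuous (𝓕 (fun x => (u x : ℂ))) := by
    by_cases hu : Integrable (fun x => (u x : ℂ))
    · exact VectorFourier.fourierIntegral_continuous Real.continuous_fourierChar
        (by fun_prop) hu
    · have : 𝓕 (fun x => (u x : ℂ)) = 0 := by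
        ext ξ
        rw [Real.fourier_eq]
        refine integral_undef fun h => hu ?_
        exact (Real.fourierIntegral_convergent_iff (μ := volume) ξ).1 h
      rw [this]; exact continuous_zero
  exact Continuous.aestronglyMeasurable (by unfold symbolTimesFourier; fun_prop)

lemma norm_symbolTimesFourier_le (u : ℝ → ℝ) (ξ : ℝ) :
    ‖symbolTimesFourier u ξ‖ ≤ (2 * Real.pi * ∫ x, ‖(u x : ℂ)‖) * ‖ξ‖ := by
  have h : ‖𝓕 (fun x => (u x : ℂ)) ξ‖ ≤ ∫ x, ‖(u x : ℂ)‖ :=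
    VectorFourier.norm_fourierIntegral_le_integral_norm _ _ _ _ _
  have h2 : ‖-((2 * Real.pi * |ξ| : ℝ) : ℂ)‖ = 2 * Real.pi * |ξ| := by
    rw [norm_neg, Complex.norm_real, Real.norm_of_nonneg (by positivity)]
  rw [symbolTimesFourier, norm_mul, h2, Real.norm_eq_abs]
  have h3 := mul_le_mul_of_nonneg_left h (show 0 ≤ 2 * Real.pi * |ξ| by positivity)
  linarith

lemma integrable_mul_symbolTimesFourier (u : ℝ → ℝ) (φ : 𝓢(ℝ, ℂ)) :
    Integrable (fun ξ => φ ξ * symbolTimesFourier u ξ) := by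
  refine ((φ.integrable_pow_mul volume 1).const_mul (2 * Real.pi * ∫ x, ‖(u x : ℂ)‖)).mono'
    (φ.continuous.aestronglyMeasurable.mul (aestronglyMeasurable_symbolTimesFourier u))
    (Filter.Eventually.of_forall fun ξ => ?_)
  rw [norm_mul, pow_one]
  have := mul_le_mul_of_nonneg_left (norm_symbolTimesFourier_le u ξ) (norm_nonneg (φ ξ))
  linarith

/-- The tempered distribution `φ ↦ ∫ φ(ξ) (-|k| û(k)) dξ` given by `-|k| û(k)`, `k = 2πξ`. -/
def symbolTimesFourierDistribution (u : ℝ → ℝ) : 𝓢'(ℝ, ℂ) :=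
  ContinuousLinearMap.toPointwiseConvergenceCLM _ _ _ _ <|
    SchwartzMap.mkCLMtoNormedSpace (𝕜 := ℂ) (σ := RingHom.id ℂ)
      (fun φ : 𝓢(ℝ, ℂ) => ∫ ξ, φ ξ * symbolTimesFourier u ξ)
      (fun φ ψ => by
        rw [← integral_add (integrable_mul_symbolTimesFourier u φ)
          (integrable_mul_symbolTimesFourier u ψ)]
        simp only [add_apply, add_mul])
      (fun c φ => by
        simp only [smul_apply, smul_eq_mul, mul_assoc, RingHom.id_apply]
        rw [integral_const_mul])
      (by
        have hint : Integrable (fun ξ : ℝ => (1 + ‖ξ‖) ^ (-2 : ℝ)) :=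
          integrable_one_add_norm (by simp)
        set A : ℝ := 2 * Real.pi * ∫ x, ‖(u x : ℂ)‖ with hA
        have hA0 : 0 ≤ A := mul_nonneg (by positivity) (integral_nonneg fun _ => norm_nonneg _)
        refine ⟨Finset.Iic (3, 0), (A * 2 ^ 3) * ∫ ξ : ℝ, (1 + ‖ξ‖) ^ (-2 : ℝ),
          mul_nonneg (by positivity) (integral_nonneg fun _ => by positivity), fun φ => ?_⟩
        set S := (Finset.Iic ((3, 0) : ℕ × ℕ)).sup (schwartzSeminormFamily ℂ ℝ ℂ) φ with hS
        calc ‖∫ ξ, φ ξ * symbolTimesFourier u ξ‖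
            ≤ ∫ ξ, (A * 2 ^ 3 * S) * (1 + ‖ξ‖) ^ (-2 : ℝ) := by
              refine norm_integral_le_of_norm_le (hint.const_mul _)
                (Filter.Eventually.of_forall fun ξ => ?_)
              have h1 : (1 + ‖ξ‖) ^ 3 * ‖φ ξ‖ ≤ 2 ^ 3 * S := by
                have h := SchwartzMap.one_add_le_sup_seminorm_apply (𝕜 := ℂ)
                  (m := (3, 0)) (k := 3) (n := 0) le_rfl le_rfl φ ξ
                rw [norm_iteratedFDeriv_zero] at h
                exact h
              have h2 := mul_le_mul_of_nonneg_left (norm_symbolTimesFourier_le u ξ)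
                (norm_nonneg (φ ξ))
              have h0 : (0 : ℝ) < 1 + ‖ξ‖ := by positivity
              rw [norm_mul, Real.rpow_neg h0.le, ← div_eq_mul_inv,
                show (2 : ℝ) = ((2 : ℕ) : ℝ) by norm_num, Real.rpow_natCast,
                le_div_iff₀ (by positivity)]
              push_cast
              calc ‖φ ξ‖ * ‖symbolTimesFourier u ξ‖ * (1 + ‖ξ‖) ^ 2
                  ≤ ‖φ ξ‖ * (A * ‖ξ‖) * (1 + ‖ξ‖) ^ 2 := by gcongr
                _ ≤ ‖φ ξ‖ * (A * (1 + ‖ξ‖)) * (1 + ‖ξ‖) ^ 2 := by gcongr; linarith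
                _ = A * ((1 + ‖ξ‖) ^ 3 * ‖φ ξ‖) := by ring
                _ ≤ A * (2 ^ 3 * S) := by gcongr
                _ = A * 2 ^ 3 * S := by ring
          _ = (A * 2 ^ 3) * (∫ ξ : ℝ, (1 + ‖ξ‖) ^ (-2 : ℝ)) * S := by
              rw [integral_const_mul]; ring)

/-- The operator `I(u) = -(-Δ)^{1/2} u` for an integrable function `u` on `ℝ`: the tempered
distribution whose Fourier transform is `-|k| û(k)`. -/
def opI (u : ℝ → ℝ) : 𝓢'(ℝ, ℂ) := 𝓕⁻ (symbolTimesFourierDistribution u)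

end HydraulicFracture

end

/-!
The kernel `g(x,z)` is bounded by `π⁻¹ √(1-x²) √(1-z²)` (`abs_greeng_le`), because `arsinh s ≤ s`.
Against `|f(z)| ≤ C_f (1-z²)^a` with `a > -3/2` this gives the absolute convergence and the bound on
the potential `U`.

Since `∂ₓ G(x,z) = π⁻¹ √(1-z²) / (√(1-x²) (z-x))`, differentiating the factors `z ∓ x` and the two
Green functions in `g` leaves `∂ₓ g(x,z) = ½ (G(x,-z) - G(x,z))`; the remaining terms cancel.
The same formula for `∂ₓ G` yields an explicit antiderivative of `G(·,z)` and hence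
`∫ G(t,z) dt = √(1-z²)` (`integral_greenG_left`), which is what makes Fubini's theorem available:
`U` is the primitive of the Green potential of `½ (f(-z) - f(z))` (`potential_eq_integral`). That
potential is integrable on `ℝ`, and continuous in `(-1,1)` because `t ↦ G(t,·)` is continuous into
`L¹` (`tendsto_integral_abs_greenG_sub`). So `U` is absolutely continuous on `ℝ` and `C¹` in
`(-1,1)`, and for odd `f` its derivative is the Green potential of `-f`.

It remains to see that `G` inverts `(-Δ)^{1/2}` in `(-1,1)`, in the transposed form
`∫ G(x,z) (-Δ)^{1/2}φ(x) dx = φ(z)` for test functions `φ` (`greenPotential_halfLaplacian`). Inserting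
a factor `exp(-ε|k|)` into the Fourier multiplier `|k|` identifies `(-Δ)^{1/2} φ` with the logarithmic
potential `π⁻¹ ∫ φ''(y) log|x-y| dy` (`fourier_abs_mul_fourierInv`). Both sides of the identity are
continuous, so it is enough to compare their integrals against the Chebyshev polynomials `U_k`, which
span the polynomials. In the variable `x = cos θ` the functions `G` and `log|x-y|` split into terms
`log|sin((θ ± η)/2)|`, whose Fourier coefficients are explicit. They give
`∫ G(x,z) U_k(z) dz = √(1-x²) U_k(x) / (k+1)` (`integral_greenG_mul_U`) and show that the logarithmic
potential of `√(1-x²) U_k(x)` is a polynomial with second derivative `π (k+1) U_k`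
(`exists_polynomial_integral_log`); two integrations by parts then match the moments.
-/

noncomputable section

namespace HydraulicFracture
open Filter Topology
open Polynomial (Chebyshev.T Chebyshev.U)

/-! ### The Green functions `G` and `g` -/

lemma one_sub_sq_pos {x : ℝ} (hx : x ∈ Ioo (-1 : ℝ) 1) : 0 < 1 - x ^ 2 := by
  nlinarith [hx.1, hx.2]

lemma one_sub_sq_nonpos {x : ℝ} (hx : x ∉ Ioo (-1 : ℝ) 1) : 1 - x ^ 2 ≤ 0 := by
  by_contra! h
  exact hx ⟨by nlinarith, by nlinarith⟩

lemma neg_mem_Ioo_iff {x : ℝ} : -x ∈ Ioo (-1 : ℝ) 1 ↔ x ∈ Ioo (-1 : ℝ) 1 := by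
  simp only [mem_Ioo]
  constructor <;> rintro ⟨h1, h2⟩ <;> constructor <;> linarith

/-- For `z ∈ (-1,1)` the closed formula for the Green function holds for every real `x`, because
the square root of a nonpositive number is `0`. -/
lemma greenG_eq {z : ℝ} (hz : z ∈ Ioo (-1 : ℝ) 1) (x : ℝ) :
    greenG x z = Real.pi⁻¹ * Real.arsinh (√((1 - x ^ 2) * (1 - z ^ 2) / (x - z) ^ 2)) := by
  by_cases hx : x ∈ Ioo (-1 : ℝ) 1
  · simp [greenG, hx, hz]
  · have h0 : (1 - x ^ 2) * (1 - z ^ 2) / (x - z) ^ 2 ≤ 0 :=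
      div_nonpos_of_nonpos_of_nonneg
        (mul_nonpos_of_nonpos_of_nonneg (one_sub_sq_nonpos hx) (one_sub_sq_pos hz).le)
        (sq_nonneg _)
    rw [Real.sqrt_eq_zero_of_nonpos h0]
    simp [greenG, hx]

lemma greenG_eq_zero_of_left {x : ℝ} (hx : x ∉ Ioo (-1 : ℝ) 1) (z : ℝ) : greenG x z = 0 := by
  simp [greenG, hx]

lemma greenG_eq_zero_of_right {z : ℝ} (hz : z ∉ Ioo (-1 : ℝ) 1) (x : ℝ) : greenG x z = 0 := by
  simp [greenG, hz]

lemma greenG_comm (x z : ℝ) : greenG x z = greenG z x := by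
  have h : (1 - x ^ 2) * (1 - z ^ 2) / (x - z) ^ 2 = (1 - z ^ 2) * (1 - x ^ 2) / (z - x) ^ 2 := by
    rw [mul_comm (1 - x ^ 2), ← neg_sub z x, neg_sq]
  simp only [greenG, and_comm, h]

lemma greenG_nonneg (x z : ℝ) : 0 ≤ greenG x z := by
  unfold greenG
  split_ifs
  · exact mul_nonneg (by positivity) (Real.arsinh_nonneg_iff.2 (Real.sqrt_nonneg _))
  · exact le_rfl

@[fun_prop]
lemma measurable_greenG : Measurable (fun p : ℝ × ℝ => greenG p.1 p.2) := by
  unfold greenG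
  refine Measurable.ite ?_ ?_ measurable_const
  · exact (measurableSet_Ioo.preimage measurable_fst).inter
      (measurableSet_Ioo.preimage measurable_snd)
  · have := Real.continuous_arsinh.measurable
    fun_prop

lemma measurable_greenG_right (x : ℝ) : Measurable (fun z => greenG x z) :=
  measurable_greenG.comp (measurable_const.prodMk measurable_id)

lemma arsinh_le_self {s : ℝ} (hs : 0 ≤ s) : Real.arsinh s ≤ s := by
  have h := Real.self_le_sinh_iff.2 hs
  calc Real.arsinh s ≤ Real.arsinh (Real.sinh s) := Real.arsinh_le_arsinh.2 h
    _ = s := Real.arsinh_sinh s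

lemma arsinh_le_two_mul_sqrt {s : ℝ} (hs : 0 ≤ s) : Real.arsinh s ≤ 2 * √(2 * s) := by
  have h1 : √(1 + s ^ 2) ≤ 1 + s := Real.sqrt_le_iff.2 ⟨by linarith, by nlinarith⟩
  have h2 : s + √(1 + s ^ 2) ≤ (1 + √(2 * s)) ^ 2 := by
    have := Real.sq_sqrt (show 0 ≤ 2 * s by linarith)
    nlinarith [Real.sqrt_nonneg (2 * s)]
  have h0 : 0 < s + √(1 + s ^ 2) := by positivity
  have h3 : 0 < 1 + √(2 * s) := by positivity
  calc Real.arsinh s = Real.log (s + √(1 + s ^ 2)) := rfl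
    _ ≤ Real.log ((1 + √(2 * s)) ^ 2) := Real.log_le_log h0 h2
    _ = 2 * Real.log (1 + √(2 * s)) := by rw [Real.log_pow]; norm_num
    _ ≤ 2 * √(2 * s) := by
      have := Real.log_le_sub_one_of_pos h3
      linarith

lemma greenG_eq_div {z : ℝ} (hz : z ∈ Ioo (-1 : ℝ) 1) (x : ℝ) :
    greenG x z = Real.pi⁻¹ * Real.arsinh (√(1 - x ^ 2) * √(1 - z ^ 2) / |z - x|) := by
  rw [greenG_eq hz, Real.sqrt_div' _ (sq_nonneg _), Real.sqrt_sq_eq_abs,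
    Real.sqrt_mul' _ (one_sub_sq_pos hz).le, abs_sub_comm]

lemma abs_sub_mul_greenG_le (x z : ℝ) :
    |z - x| * greenG x z ≤ Real.pi⁻¹ * (√(1 - x ^ 2) * √(1 - z ^ 2)) := by
  by_cases hz : z ∈ Ioo (-1 : ℝ) 1
  · rw [greenG_eq_div hz]
    rcases eq_or_ne z x with rfl | hne
    · simp only [sub_self, abs_zero, zero_mul]; positivity
    · have hd : 0 < |z - x| := abs_pos.2 (sub_ne_zero.2 hne)
      have := arsinh_le_self (s := √(1 - x ^ 2) * √(1 - z ^ 2) / |z - x|) (by positivity)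
      calc |z - x| * (Real.pi⁻¹ * Real.arsinh (√(1 - x ^ 2) * √(1 - z ^ 2) / |z - x|))
          ≤ |z - x| * (Real.pi⁻¹ * (√(1 - x ^ 2) * √(1 - z ^ 2) / |z - x|)) := by gcongr
        _ = _ := by field_simp
  · rw [greenG_eq_zero_of_right hz, mul_zero]; positivity

/-- Unlike `abs_sub_mul_greenG_le`, this bound tends to `0` at the diagonal. -/
lemma abs_sub_mul_greenG_le_sqrt (x z : ℝ) : |z - x| * greenG x z ≤ 2 * √(2 * |z - x|) := by
  by_cases hz : z ∈ Ioo (-1 : ℝ) 1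
  · rw [greenG_eq_div hz]
    rcases eq_or_ne z x with rfl | hne
    · simp
    · have hd : 0 < |z - x| := abs_pos.2 (sub_ne_zero.2 hne)
      have h1 : √(1 - x ^ 2) ≤ 1 := Real.sqrt_le_one.2 (by nlinarith [sq_nonneg x])
      have h2 : √(1 - z ^ 2) ≤ 1 := Real.sqrt_le_one.2 (by nlinarith [sq_nonneg z])
      have h3 : √(1 - x ^ 2) * √(1 - z ^ 2) ≤ 1 := mul_le_one₀ h1 (Real.sqrt_nonneg _) h2
      have h4 : Real.arsinh (√(1 - x ^ 2) * √(1 - z ^ 2) / |z - x|) ≤ 2 * √(2 * (1 / |z - x|)) :=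
        (arsinh_le_two_mul_sqrt (by positivity)).trans (by gcongr)
      have h5 : Real.pi⁻¹ ≤ 1 := inv_le_one_of_one_le₀ (by linarith [Real.pi_gt_three])
      calc |z - x| * (Real.pi⁻¹ * Real.arsinh (√(1 - x ^ 2) * √(1 - z ^ 2) / |z - x|))
          ≤ |z - x| * (1 * (2 * √(2 * (1 / |z - x|)))) := by
            have : 0 ≤ Real.arsinh (√(1 - x ^ 2) * √(1 - z ^ 2) / |z - x|) :=
              Real.arsinh_nonneg_iff.2 (by positivity)
            gcongr
        _ = 2 * (√(|z - x| ^ 2) * √(2 * (1 / |z - x|))) := by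
            rw [Real.sqrt_sq hd.le]; ring
        _ = 2 * √(2 * |z - x|) := by
            rw [← Real.sqrt_mul (sq_nonneg _)]; congr 2; field_simp
  · rw [greenG_eq_zero_of_right hz, mul_zero]; positivity

lemma continuousAt_greenG_left {x z : ℝ} (hz : z ∈ Ioo (-1 : ℝ) 1) (hxz : x ≠ z) :
    ContinuousAt (fun t => greenG t z) x := by
  simp_rw [greenG_eq hz]
  have h : ContinuousAt (fun t : ℝ => √((1 - t ^ 2) * (1 - z ^ 2) / (t - z) ^ 2)) x :=
    (ContinuousAt.div (f := fun t : ℝ => (1 - t ^ 2) * (1 - z ^ 2)) (g := fun t => (t - z) ^ 2)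
      (by fun_prop) (by fun_prop) (pow_ne_zero 2 (sub_ne_zero.2 hxz))).sqrt
  exact continuousAt_const.mul (Real.continuous_arsinh.continuousAt.comp h)

/-- The factor `z - x` removes the logarithmic singularity of the Green function. -/
lemma continuous_sub_mul_greenG (z : ℝ) : Continuous (fun t => (z - t) * greenG t z) := by
  by_cases hz : z ∈ Ioo (-1 : ℝ) 1
  · refine continuous_iff_continuousAt.2 fun x => ?_
    rcases eq_or_ne x z with rfl | hne
    · have h1 : Tendsto (fun t : ℝ => 2 * √(2 * |x - t|)) (𝓝 x) (𝓝 0) := by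
        have : Continuous (fun t : ℝ => 2 * √(2 * |x - t|)) := by fun_prop
        simpa using this.tendsto x
      have h2 : Tendsto (fun t => (x - t) * greenG t x) (𝓝 x) (𝓝 0) := by
        refine squeeze_zero_norm (fun t => ?_) h1
        rw [norm_mul, Real.norm_eq_abs, Real.norm_of_nonneg (greenG_nonneg _ _)]
        exact abs_sub_mul_greenG_le_sqrt t x
      simpa [ContinuousAt] using h2
    · exact ContinuousAt.mul (by fun_prop) (continuousAt_greenG_left hz hne)
  · simp [greenG_eq_zero_of_right hz, continuous_const]

lemma hasDerivAt_greenG {x z : ℝ} (hx : x ∈ Ioo (-1 : ℝ) 1) (hz : z ∈ Ioo (-1 : ℝ) 1)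
    (hxz : x ≠ z) :
    HasDerivAt (fun t => greenG t z)
      (Real.pi⁻¹ * (√(1 - z ^ 2) / (√(1 - x ^ 2) * (z - x)))) x := by
  have hx0 := one_sub_sq_pos hx
  have hz0 := one_sub_sq_pos hz
  have hd : x - z ≠ 0 := sub_ne_zero.2 hxz
  have hd' : z - x ≠ 0 := sub_ne_zero.2 hxz.symm
  have hxz1 : 0 < 1 - x * z := by nlinarith [hx.1, hx.2, hz.1, hz.2]
  simp_rw [greenG_eq hz]
  have hq : 0 < (1 - x ^ 2) * (1 - z ^ 2) / (x - z) ^ 2 := by positivity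
  have h1 : HasDerivAt (fun t : ℝ => (1 - t ^ 2) * (1 - z ^ 2) / (t - z) ^ 2)
      (((-(2 * x)) * (1 - z ^ 2) * (x - z) ^ 2 - (1 - x ^ 2) * (1 - z ^ 2) * (2 * (x - z)))
        / ((x - z) ^ 2) ^ 2) x := by
    have ha : HasDerivAt (fun t : ℝ => (1 - t ^ 2) * (1 - z ^ 2)) ((-(2 * x)) * (1 - z ^ 2)) x := by
      simpa using (((hasDerivAt_id x).fun_pow 2).const_sub 1).mul_const (1 - z ^ 2)
    have hb : HasDerivAt (fun t : ℝ => (t - z) ^ 2) (2 * (x - z)) x := by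
      simpa using ((hasDerivAt_id x).sub_const z).fun_pow 2
    exact ha.div hb (pow_ne_zero 2 hd)
  have h2 := ((Real.hasDerivAt_arsinh _).comp x (h1.sqrt hq.ne')).const_mul Real.pi⁻¹
  refine h2.congr_deriv ?_
  congr 1
  -- `1 + (1-x²)(1-z²)/(x-z)² = ((1-xz)/(x-z))²`
  have e1 : √(1 + √((1 - x ^ 2) * (1 - z ^ 2) / (x - z) ^ 2) ^ 2) = (1 - x * z) / |x - z| := by
    rw [Real.sq_sqrt hq.le, ← Real.sqrt_sq (show 0 ≤ (1 - x * z) / |x - z| by positivity)]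
    congr 1
    rw [div_pow, sq_abs]
    field_simp
    ring
  have e2 : √((1 - x ^ 2) * (1 - z ^ 2) / (x - z) ^ 2)
      = √(1 - x ^ 2) * √(1 - z ^ 2) / |x - z| := by
    rw [Real.sqrt_div' _ (sq_nonneg _), Real.sqrt_sq_eq_abs, Real.sqrt_mul' _ hz0.le]
  rw [e1, e2]
  have hsx := Real.sqrt_pos.2 hx0
  have hsz := Real.sqrt_pos.2 hz0
  have hz2 : 1 - z ^ 2 = √(1 - z ^ 2) ^ 2 := (Real.sq_sqrt hz0.le).symm
  set s := √(1 - z ^ 2) with hs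
  set r := √(1 - x ^ 2) with hr
  have ha : |x - z| ≠ 0 := abs_ne_zero.2 hd
  have ha2 : |x - z| ^ 2 = (x - z) ^ 2 := sq_abs _
  rw [hz2]
  have e3 : (-(2 * x)) * s ^ 2 * (x - z) ^ 2 - (1 - x ^ 2) * s ^ 2 * (2 * (x - z))
      = -(2 * s ^ 2 * (x - z) * (1 - x * z)) := by ring
  rw [e3]
  have e4 : ((1 - x * z) / |x - z|)⁻¹ *
      (-(2 * s ^ 2 * (x - z) * (1 - x * z)) / ((x - z) ^ 2) ^ 2 / (2 * (r * s / |x - z|)))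
      = -(s * |x - z| ^ 2 / (r * (x - z) ^ 3)) := by
    field_simp
  rw [e4, ha2, ← neg_sub x z]
  field_simp

/-- The function `t ↦ (t-z) G(t,z) + π⁻¹ √(1-z²) arcsin t` is an antiderivative of `G(·,z)`. -/
lemma hasDerivAt_antiderivative_greenG {x z : ℝ} (hx : x ∈ Ioo (-1 : ℝ) 1)
    (hz : z ∈ Ioo (-1 : ℝ) 1) (hxz : x ≠ z) :
    HasDerivAt (fun t => -((z - t) * greenG t z) + Real.pi⁻¹ * √(1 - z ^ 2) * Real.arcsin t)
      (greenG x z) x := by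
  have h1 := (((hasDerivAt_id x).const_sub z).mul (hasDerivAt_greenG hx hz hxz)).neg
  have h2 := (Real.hasDerivAt_arcsin (x := x) (by linarith [hx.1]) (by linarith [hx.2])).const_mul
    (Real.pi⁻¹ * √(1 - z ^ 2))
  refine (h1.add h2).congr_deriv ?_
  have hd' : z - x ≠ 0 := sub_ne_zero.2 hxz.symm
  have hsx := Real.sqrt_pos.2 (one_sub_sq_pos hx)
  simp only [id]
  field_simp
  ring

lemma intervalIntegrable_greenG_left (z : ℝ) :
    IntervalIntegrable (fun t => greenG t z) volume (-1) 1 := by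
  by_cases hz : z ∈ Ioo (-1 : ℝ) 1
  · have hc : Continuous
        (fun t => -((z - t) * greenG t z) + Real.pi⁻¹ * √(1 - z ^ 2) * Real.arcsin t) :=
      (continuous_sub_mul_greenG z).neg.add (continuous_const.mul Real.continuous_arcsin)
    refine IntervalIntegrable.trans (b := z) ?_ ?_
    · refine intervalIntegral.intervalIntegrable_deriv_of_nonneg hc.continuousOn
        (fun x hx => ?_) fun x _ => greenG_nonneg x z
      rw [min_eq_left hz.1.le, max_eq_right hz.1.le] at hx
      exact hasDerivAt_antiderivative_greenG ⟨hx.1, hx.2.trans hz.2⟩ hz hx.2.ne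
    · refine intervalIntegral.intervalIntegrable_deriv_of_nonneg hc.continuousOn
        (fun x hx => ?_) fun x _ => greenG_nonneg x z
      rw [min_eq_left hz.2.le, max_eq_right hz.2.le] at hx
      exact hasDerivAt_antiderivative_greenG ⟨hz.1.trans hx.1, hx.2⟩ hz hx.1.ne'
  · simp [greenG_eq_zero_of_right hz]

lemma integrable_greenG_left (z : ℝ) : Integrable (fun t => greenG t z) := by
  have h : IntegrableOn (fun t => greenG t z) (Ioo (-1) 1) :=
    ((intervalIntegrable_iff_integrableOn_Ioc_of_le (by norm_num)).1
      (intervalIntegrable_greenG_left z)).mono_set Ioo_subset_Ioc_self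
  refine (integrableOn_iff_integrable_of_support_subset fun t ht => ?_).1 h
  by_contra hn
  exact ht (greenG_eq_zero_of_left hn z)

lemma integrable_greenG_right (x : ℝ) : Integrable (fun z => greenG x z) := by
  simp_rw [greenG_comm x]
  exact integrable_greenG_left x

/-- The solution of `(-Δ)^{1/2} u = 1` in `(-1,1)` with zero exterior values is `√(1-z²)`. -/
lemma integral_greenG_left (z : ℝ) : ∫ t, greenG t z = √(1 - z ^ 2) := by
  by_cases hz : z ∈ Ioo (-1 : ℝ) 1
  · have h1 : ∫ t, greenG t z = ∫ t in (-1 : ℝ)..1, greenG t z := by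
      rw [intervalIntegral.integral_of_le (by norm_num), ← integral_Icc_eq_integral_Ioc,
        setIntegral_eq_integral_of_forall_compl_eq_zero]
      exact fun t ht => greenG_eq_zero_of_left (fun h => ht (Ioo_subset_Icc_self h)) z
    have hc : Continuous
        (fun t => -((z - t) * greenG t z) + Real.pi⁻¹ * √(1 - z ^ 2) * Real.arcsin t) :=
      (continuous_sub_mul_greenG z).neg.add (continuous_const.mul Real.continuous_arcsin)
    rw [h1, integral_eq_of_hasDerivAt_off_countable_of_le _ _ (by norm_num)
      (countable_singleton z) hc.continuousOn
      (fun x hx => hasDerivAt_antiderivative_greenG hx.1 hz hx.2)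
      (intervalIntegrable_greenG_left z)]
    have e1 : greenG 1 z = 0 := greenG_eq_zero_of_left (by simp) z
    have e2 : greenG (-1) z = 0 := greenG_eq_zero_of_left (by simp) z
    rw [e1, e2, Real.arcsin_one, Real.arcsin_neg_one]
    have := Real.pi_pos
    field_simp
    ring
  · rw [Real.sqrt_eq_zero_of_nonpos (one_sub_sq_nonpos hz)]
    simp [greenG_eq_zero_of_right hz]

lemma integral_greenG_right (x : ℝ) : ∫ z, greenG x z = √(1 - x ^ 2) := by
  simp_rw [greenG_comm x]
  exact integral_greenG_left x

lemma abs_greeng_le (x z : ℝ) :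
    |greeng x z| ≤ Real.pi⁻¹ * (√(1 - x ^ 2) * √(1 - z ^ 2)) := by
  have h1 := abs_sub_mul_greenG_le x z
  have h2 := abs_sub_mul_greenG_le x (-z)
  rw [neg_sq, ← abs_neg, neg_sub, sub_neg_eq_add, add_comm x z] at h2
  unfold greeng
  rw [abs_mul]
  have h3 := abs_add_le ((z - x) * greenG x z) ((z + x) * greenG x (-z))
  rw [abs_mul, abs_mul, abs_of_nonneg (greenG_nonneg _ _), abs_of_nonneg (greenG_nonneg _ _)] at h3
  rw [abs_of_pos (by norm_num : (0 : ℝ) < 1 / 2)]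
  linarith

lemma continuous_greeng_left (z : ℝ) : Continuous (fun x => greeng x z) := by
  have h1 := continuous_sub_mul_greenG z
  have h2 := (continuous_sub_mul_greenG (-z)).neg
  refine ((continuous_const (y := (1 / 2 : ℝ))).mul (h1.add h2)).congr fun x => ?_
  change 1 / 2 * ((z - x) * greenG x z + -((-z - x) * greenG x (-z))) = greeng x z
  rw [greeng]
  ring

@[fun_prop]
lemma measurable_greeng : Measurable (fun p : ℝ × ℝ => greeng p.1 p.2) := by
  have h1 := measurable_greenG
  have h2 : Measurable (fun p : ℝ × ℝ => greenG p.1 (-p.2)) :=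
    measurable_greenG.comp (measurable_fst.prodMk measurable_snd.neg)
  unfold greeng
  fun_prop

/-- The derivatives of the factors `z ∓ x` and of the Green functions in `g` contribute
opposite multiples of `√(1-z²)/√(1-x²)`, which cancel. -/
lemma hasDerivAt_greeng {x z : ℝ} (hx : x ∈ Ioo (-1 : ℝ) 1) (hz : z ∈ Ioo (-1 : ℝ) 1)
    (hxz : x ≠ z) (hxz' : x ≠ -z) :
    HasDerivAt (fun t => greeng t z) (1 / 2 * (greenG x (-z) - greenG x z)) x := by
  have h1 := ((hasDerivAt_id x).const_sub z).mul (hasDerivAt_greenG hx hz hxz)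
  have h2 := ((hasDerivAt_id x).const_add z).mul
    (hasDerivAt_greenG hx (neg_mem_Ioo_iff.2 hz) hxz')
  have hd' : z - x ≠ 0 := sub_ne_zero.2 hxz.symm
  have hd : z + x ≠ 0 := fun h => hxz' (by linarith)
  have hd2 : -z - x ≠ 0 := fun h => hxz' (by linarith)
  have hsx := Real.sqrt_pos.2 (one_sub_sq_pos hx)
  refine ((h1.add h2).const_mul (1 / 2)).congr_deriv ?_
  rw [neg_sq, show -z - x = -(z + x) by ring]
  simp only [id]
  field_simp
  ring

lemma greeng_eq_integral {x z : ℝ} (hx : x ∈ Icc (-1 : ℝ) 1) (hz : z ∈ Ioo (-1 : ℝ) 1) :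
    greeng x z = ∫ t in (-1 : ℝ)..x, 1 / 2 * (greenG t (-z) - greenG t z) := by
  have hsub : uIcc (-1) x ⊆ uIcc (-1 : ℝ) 1 := by
    rw [uIcc_of_le hx.1, uIcc_of_le (by norm_num)]
    exact Icc_subset_Icc_right hx.2
  rw [integral_eq_of_hasDerivAt_off_countable_of_le (fun t => greeng t z) _ hx.1
    (s := {z, -z}) (Set.to_countable _) (continuous_greeng_left z).continuousOn
    (fun t ht => by
      simp only [Set.mem_sdiff, mem_insert_iff, mem_singleton_iff, not_or] at ht
      exact hasDerivAt_greeng ⟨ht.1.1, ht.1.2.trans_le hx.2⟩ hz ht.2.1 ht.2.2)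
    ((((intervalIntegrable_greenG_left _).sub (intervalIntegrable_greenG_left _)).const_mul
      _).mono_set hsub)]
  have e : ∀ w, greenG (-1) w = 0 := greenG_eq_zero_of_left (by simp)
  simp [greeng, e]

/-! ### Potentials of the Green function -/

/-- Densities on `(-1,1)`, extended to `ℝ`, that the Green function can be integrated against:
locally bounded in `(-1,1)` and integrable with the weight `√(1-z²)`. The weight vanishes off
`(-1,1)`, so nothing but measurability is required there. -/
structure IsSource (h : ℝ → ℝ) : Prop where
  aestronglyMeasurable : AEStronglyMeasurable h volume
  integrable : Integrable (fun z => √(1 - z ^ 2) * h z)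
  bounded : ∀ r < 1, ∃ M, ∀ z, |z| ≤ r → |h z| ≤ M

lemma IsSource.comp_neg {h : ℝ → ℝ} (hh : IsSource h) : IsSource (fun z => h (-z)) where
  aestronglyMeasurable :=
    hh.aestronglyMeasurable.comp_measurePreserving (Measure.measurePreserving_neg volume)
  integrable := by simpa using hh.integrable.comp_neg
  bounded r hr := by
    obtain ⟨M, hM⟩ := hh.bounded r hr
    exact ⟨M, fun z hz => hM (-z) (by rwa [abs_neg])⟩

lemma IsSource.of_continuous {h : ℝ → ℝ} (hh : Continuous h) : IsSource h where
  aestronglyMeasurable := hh.aestronglyMeasurable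
  integrable := by
    refine Continuous.integrable_of_hasCompactSupport (by fun_prop)
      (HasCompactSupport.intro (isCompact_Icc (a := (-1 : ℝ)) (b := 1)) fun z hz => ?_)
    rw [Real.sqrt_eq_zero_of_nonpos (one_sub_sq_nonpos fun h => hz (Ioo_subset_Icc_self h)),
      zero_mul]
  bounded r _ := by
    obtain ⟨M, hM⟩ := (isCompact_Icc (a := -r) (b := r)).exists_bound_of_continuousOn
      hh.continuousOn
    exact ⟨M, fun z hz => hM z (abs_le.1 hz)⟩

/-- The potential `x ↦ ∫ G(x,z) h(z) dz` of the density `h`. -/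
def greenPotential (h : ℝ → ℝ) (x : ℝ) : ℝ := ∫ z, greenG x z * h z

lemma greenPotential_eq_zero (h : ℝ → ℝ) {x : ℝ} (hx : x ∉ Ioo (-1 : ℝ) 1) :
    greenPotential h x = 0 := by
  simp [greenPotential, greenG_eq_zero_of_left hx]

lemma IsSource.integrable_prod {h : ℝ → ℝ} (hh : IsSource h) :
    Integrable (fun p : ℝ × ℝ => greenG p.1 p.2 * h p.2) (volume.prod volume) := by
  have hm : AEStronglyMeasurable (fun p : ℝ × ℝ => greenG p.1 p.2 * h p.2) (volume.prod volume) :=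
    measurable_greenG.aestronglyMeasurable.mul hh.aestronglyMeasurable.comp_snd
  refine (integrable_prod_iff' hm).2
    ⟨Eventually.of_forall fun z => (integrable_greenG_left z).mul_const (h z), ?_⟩
  refine hh.integrable.norm.congr (Eventually.of_forall fun z => ?_)
  simp only [norm_mul, Real.norm_of_nonneg (greenG_nonneg _ _), Real.norm_of_nonneg
    (Real.sqrt_nonneg _)]
  rw [integral_mul_const, integral_greenG_left]

lemma IsSource.integrable_greenPotential {h : ℝ → ℝ} (hh : IsSource h) :
    Integrable (greenPotential h) :=
  hh.integrable_prod.integral_prod_left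

/-- Away from the singularity the Green function decays like `√(1-z²)`. -/
lemma greenG_le_of_le_abs_sub {x z δ : ℝ} (hδ : 0 < δ) (h : δ ≤ |z - x|) :
    greenG x z ≤ (Real.pi⁻¹ / δ) * √(1 - z ^ 2) := by
  have h1 := abs_sub_mul_greenG_le x z
  have h2 : √(1 - x ^ 2) ≤ 1 := Real.sqrt_le_one.2 (by nlinarith [sq_nonneg x])
  have h3 : δ * greenG x z ≤ Real.pi⁻¹ * (1 * √(1 - z ^ 2)) :=
    calc δ * greenG x z ≤ |z - x| * greenG x z :=
          mul_le_mul_of_nonneg_right h (greenG_nonneg _ _)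
      _ ≤ _ := h1
      _ ≤ _ := by gcongr
  rw [div_mul_eq_mul_div, le_div_iff₀ hδ]
  linarith

lemma IsSource.integrable_greenG_mul {h : ℝ → ℝ} (hh : IsSource h) (x : ℝ) :
    Integrable (fun z => greenG x z * h z) := by
  by_cases hx : x ∈ Ioo (-1 : ℝ) 1
  · have hx1 : |x| < 1 := abs_lt.2 hx
    set r := (1 + |x|) / 2 with hr
    obtain ⟨M, hM⟩ := hh.bounded r (by linarith)
    have hδ : 0 < r - |x| := by linarith
    refine (((integrable_greenG_right x).mul_const M).add
      (hh.integrable.norm.const_mul (Real.pi⁻¹ / (r - |x|)))).mono'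
      ((measurable_greenG_right x).aestronglyMeasurable.mul hh.aestronglyMeasurable)
      (Eventually.of_forall fun z => ?_)
    have hM0 : 0 ≤ M := (abs_nonneg _).trans (hM 0 (by simpa using by positivity))
    simp only [norm_mul, Real.norm_of_nonneg (greenG_nonneg _ _), Real.norm_of_nonneg
      (Real.sqrt_nonneg _), Real.norm_eq_abs, Pi.add_apply]
    by_cases hz : |z| ≤ r
    · have : 0 ≤ Real.pi⁻¹ / (r - |x|) * (√(1 - z ^ 2) * |h z|) := by positivity
      have := mul_le_mul_of_nonneg_left (hM z hz) (greenG_nonneg x z)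
      linarith
    · have h1 : r - |x| ≤ |z - x| := by
        have := abs_sub_abs_le_abs_sub z x
        push Not at hz
        linarith
      have h2 := mul_le_mul_of_nonneg_right (greenG_le_of_le_abs_sub hδ h1) (abs_nonneg (h z))
      have h3 : 0 ≤ greenG x z * M := mul_nonneg (greenG_nonneg _ _) hM0
      linarith
  · simp [greenG_eq_zero_of_left hx]

lemma ae_continuousAt_greenG (x : ℝ) : ∀ᵐ z, ContinuousAt (fun t => greenG t z) x := by
  have h : ∀ᵐ z : ℝ, z ≠ x := by simp [ae_iff, measure_singleton]
  filter_upwards [h] with z hz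
  by_cases hz1 : z ∈ Ioo (-1 : ℝ) 1
  · exact continuousAt_greenG_left hz1 hz.symm
  · simpa [greenG_eq_zero_of_right hz1] using continuousAt_const

/-- The map `t ↦ G(t,·)` is continuous into `L¹`, by Scheffé's argument: the Green function is
nonnegative, converges almost everywhere, and its integrals `√(1-t²)` converge. -/
lemma tendsto_integral_abs_greenG_sub (x : ℝ) :
    Tendsto (fun t => ∫ z, |greenG t z - greenG x z|) (𝓝 x) (𝓝 0) := by
  have h1 : Tendsto (fun t => ∫ z, max (greenG x z - greenG t z) 0) (𝓝 x) (𝓝 (∫ _ : ℝ, 0)) := by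
    refine tendsto_integral_filter_of_dominated_convergence (fun z => greenG x z)
      (Eventually.of_forall fun t => (((measurable_greenG_right x).sub
        (measurable_greenG_right t)).max measurable_const).aestronglyMeasurable)
      (Eventually.of_forall fun t => Eventually.of_forall fun z => ?_)
      (integrable_greenG_right x) ?_
    · rw [Real.norm_of_nonneg (le_max_right _ _)]
      exact max_le (by linarith [greenG_nonneg t z]) (greenG_nonneg x z)
    · filter_upwards [ae_continuousAt_greenG x] with z hz
      have := (tendsto_const_nhds (x := greenG x z)).sub hz.tendsto
      simpa using this.max (tendsto_const_nhds (x := (0 : ℝ)))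
  have h2 : Tendsto (fun t : ℝ => √(1 - t ^ 2) - √(1 - x ^ 2)) (𝓝 x) (𝓝 0) := by
    have : Continuous (fun t : ℝ => √(1 - t ^ 2) - √(1 - x ^ 2)) := by fun_prop
    simpa using this.tendsto x
  have h3 := (h1.const_mul 2).add h2
  simp only [integral_zero, mul_zero, add_zero] at h3
  refine h3.congr fun t => ?_
  have hi1 : Integrable (fun z => greenG t z - greenG x z) :=
    (integrable_greenG_right t).sub (integrable_greenG_right x)
  have hi2 : Integrable (fun z => max (greenG x z - greenG t z) 0) :=
    ((integrable_greenG_right x).sub (integrable_greenG_right t)).pos_part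
  rw [← integral_greenG_right t, ← integral_greenG_right x,
    ← integral_sub (integrable_greenG_right t) (integrable_greenG_right x),
    ← integral_const_mul, ← integral_add (hi2.const_mul 2) hi1]
  refine integral_congr_ae (Eventually.of_forall fun z => ?_)
  simp only
  rcases le_total (greenG x z) (greenG t z) with h | h
  · rw [max_eq_right (by linarith), abs_of_nonneg (by linarith)]
    ring
  · rw [max_eq_left (by linarith), abs_of_nonpos (by linarith)]
    ring

lemma IsSource.continuousOn_greenPotential {h : ℝ → ℝ} (hh : IsSource h) :
    ContinuousOn (greenPotential h) (Ioo (-1) 1) := by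
  intro x hx
  refine ContinuousAt.continuousWithinAt ?_
  have hx1 : |x| < 1 := abs_lt.2 hx
  set r := (1 + |x|) / 2 with hr
  obtain ⟨M, hM⟩ := hh.bounded r (by linarith)
  have hM0 : 0 ≤ M := (abs_nonneg _).trans (hM 0 (by simpa using by positivity))
  have hδ : 0 < (r - |x|) / 2 := by linarith
  -- near the singularity the density is bounded and `t ↦ G(t,·)` is continuous into `L¹`;
  -- away from it dominated convergence applies
  set A : Set ℝ := {z | |z| ≤ r}
  have hA : MeasurableSet A := measurableSet_le measurable_norm measurable_const
  have key : Tendsto (fun t => ∫ z, |greenG t z - greenG x z| * |h z|) (𝓝 x) (𝓝 0) := by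
    have t1 : Tendsto (fun t => M * ∫ z, |greenG t z - greenG x z|) (𝓝 x) (𝓝 0) := by
      simpa using (tendsto_integral_abs_greenG_sub x).const_mul M
    have t2 : Tendsto (fun t => ∫ z in Aᶜ, |greenG t z - greenG x z| * |h z|) (𝓝 x)
        (𝓝 (∫ z in Aᶜ, (0 : ℝ))) := by
      refine tendsto_integral_filter_of_dominated_convergence
        (fun z => 2 * (Real.pi⁻¹ / ((r - |x|) / 2)) * ‖√(1 - z ^ 2) * h z‖)
        (Eventually.of_forall fun t => ?_) ?_ ((hh.integrable.norm.const_mul _).integrableOn) ?_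
      · have hm : AEStronglyMeasurable (fun z => greenG t z - greenG x z) volume :=
          ((measurable_greenG_right t).sub (measurable_greenG_right x)).aestronglyMeasurable
        exact (hm.norm.mul hh.aestronglyMeasurable.norm).restrict
      · have hn : ∀ᶠ t in 𝓝 x, |t - x| < (r - |x|) / 2 := by
          have : Continuous (fun t : ℝ => |t - x|) := by fun_prop
          exact (this.tendsto x).eventually_lt_const (by simpa using hδ)
        filter_upwards [hn] with t ht
        filter_upwards [ae_restrict_mem hA.compl] with z hz
        have hz' : r < |z| := not_le.1 hz
        have e1 := abs_sub_abs_le_abs_sub z x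
        have e2 := abs_sub_le z t x
        have g1 := greenG_le_of_le_abs_sub hδ (show (r - |x|) / 2 ≤ |z - t| by linarith)
        have g2 := greenG_le_of_le_abs_sub hδ (show (r - |x|) / 2 ≤ |z - x| by linarith)
        have g3 : |greenG t z - greenG x z| ≤
            2 * (Real.pi⁻¹ / ((r - |x|) / 2)) * √(1 - z ^ 2) := by
          have := greenG_nonneg t z
          have := greenG_nonneg x z
          rw [abs_le]
          constructor <;> linarith
        rw [norm_mul, norm_mul, Real.norm_of_nonneg (abs_nonneg _),
          Real.norm_of_nonneg (abs_nonneg _), Real.norm_of_nonneg (Real.sqrt_nonneg _),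
          Real.norm_eq_abs]
        have := mul_le_mul_of_nonneg_right g3 (abs_nonneg (h z))
        linarith
      · refine ae_restrict_of_ae ?_
        filter_upwards [ae_continuousAt_greenG x] with z hz
        have := ((hz.tendsto.sub_const (greenG x z)).abs).mul_const |h z|
        simpa using this
    have t3 := t1.add t2
    simp only [integral_zero, add_zero] at t3
    refine squeeze_zero (fun t => integral_nonneg fun z => by positivity) (fun t => ?_) t3
    have hi1 : Integrable (fun z => greenG t z - greenG x z) :=
      (integrable_greenG_right t).sub (integrable_greenG_right x)
    have hi : Integrable (fun z => |greenG t z - greenG x z| * |h z|) := by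
      refine ((hh.integrable_greenG_mul t).sub (hh.integrable_greenG_mul x)).norm.congr
        (Eventually.of_forall fun z => ?_)
      simp only [Pi.sub_apply, ← sub_mul, norm_mul, Real.norm_eq_abs]
    rw [← integral_add_compl hA hi]
    gcongr
    rw [← integral_const_mul]
    calc ∫ z in A, |greenG t z - greenG x z| * |h z|
        ≤ ∫ z in A, M * |greenG t z - greenG x z| := by
          refine setIntegral_mono_on hi.integrableOn (hi1.abs.const_mul M).integrableOn hA
            fun z hz => ?_
          rw [mul_comm]
          exact mul_le_mul_of_nonneg_right (hM z hz) (abs_nonneg _)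
      _ ≤ ∫ z, M * |greenG t z - greenG x z| :=
          setIntegral_le_integral (hi1.abs.const_mul M)
            (Eventually.of_forall fun z => mul_nonneg hM0 (abs_nonneg _))
  refine tendsto_iff_norm_sub_tendsto_zero.2 (squeeze_zero (fun _ => norm_nonneg _) (fun t => ?_)
    key)
  rw [greenPotential, greenPotential,
    ← integral_sub (hh.integrable_greenG_mul t) (hh.integrable_greenG_mul x)]
  refine (norm_integral_le_integral_norm _).trans_eq (integral_congr_ae
    (Eventually.of_forall fun z => ?_))
  simp only [← sub_mul, norm_mul, Real.norm_eq_abs]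

lemma abs_greenPotential_le {h : ℝ → ℝ} {M : ℝ} (hM : ∀ z, |h z| ≤ M) (x : ℝ) :
    |greenPotential h x| ≤ M * √(1 - x ^ 2) := by
  rw [greenPotential, ← integral_greenG_right, ← integral_const_mul, ← Real.norm_eq_abs]
  refine norm_integral_le_of_norm_le ((integrable_greenG_right x).const_mul M)
    (Eventually.of_forall fun z => ?_)
  rw [norm_mul, Real.norm_of_nonneg (greenG_nonneg _ _), mul_comm, Real.norm_eq_abs]
  exact mul_le_mul_of_nonneg_right (hM z) (greenG_nonneg _ _)

lemma continuous_greenPotential {h : ℝ → ℝ} (hh : Continuous h) {M : ℝ} (hM : ∀ z, |h z| ≤ M) :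
    Continuous (greenPotential h) := by
  refine continuous_iff_continuousAt.2 fun x => ?_
  by_cases hx : x ∈ Ioo (-1 : ℝ) 1
  · exact (IsSource.of_continuous hh).continuousOn_greenPotential.continuousAt
      (isOpen_Ioo.mem_nhds hx)
  · have h1 : Tendsto (fun t : ℝ => M * √(1 - t ^ 2)) (𝓝 x) (𝓝 0) := by
      have : Continuous (fun t : ℝ => M * √(1 - t ^ 2)) := by fun_prop
      simpa [Real.sqrt_eq_zero_of_nonpos (one_sub_sq_nonpos hx)] using this.tendsto x
    rw [ContinuousAt, greenPotential_eq_zero h hx]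
    exact squeeze_zero_norm (fun t => abs_greenPotential_le hM t) h1

/-! ### The potential and its derivative -/

/-- The density `½ (h(-z) - h(z))`, whose Green potential is the derivative of `potential h`. -/
def velocityDensity (h : ℝ → ℝ) (z : ℝ) : ℝ := 1 / 2 * (h (-z) - h z)

lemma IsSource.velocityDensity {h : ℝ → ℝ} (hh : IsSource h) : IsSource (velocityDensity h) where
  aestronglyMeasurable := (hh.comp_neg.aestronglyMeasurable.sub hh.aestronglyMeasurable).const_mul _
  integrable := by
    refine ((hh.comp_neg.integrable.sub hh.integrable).const_mul (1 / 2)).congr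
      (Eventually.of_forall fun z => ?_)
    simp only [Pi.sub_apply, HydraulicFracture.velocityDensity]
    ring
  bounded r hr := by
    obtain ⟨M, hM⟩ := hh.bounded r hr
    refine ⟨M, fun z hz => ?_⟩
    have h1 := hM z hz
    have h2 := hM (-z) (by rwa [abs_neg])
    rw [HydraulicFracture.velocityDensity]
    rw [abs_le] at h1 h2 ⊢
    constructor <;> linarith

lemma greenPotential_velocityDensity {h : ℝ → ℝ} (hh : IsSource h) (t : ℝ) :
    greenPotential (velocityDensity h) t =
      ∫ z, 1 / 2 * (greenG t (-z) - greenG t z) * h z := by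
  have i1 := hh.comp_neg.integrable_greenG_mul t
  have i2 := hh.integrable_greenG_mul t
  have i3 : Integrable (fun z => greenG t (-z) * h z) := by simpa using i1.comp_neg
  have e : ∫ z, greenG t z * h (-z) = ∫ z, greenG t (-z) * h z := by
    rw [← integral_neg_eq_self]
    simp
  calc greenPotential (HydraulicFracture.velocityDensity h) t
      = ∫ z, 1 / 2 * (greenG t z * h (-z) - greenG t z * h z) := by
        refine integral_congr_ae (Eventually.of_forall fun z => ?_)
        simp only [HydraulicFracture.velocityDensity]
        ring
    _ = ∫ z, 1 / 2 * (greenG t (-z) * h z - greenG t z * h z) := by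
        rw [integral_const_mul, integral_const_mul, integral_sub i1 i2, integral_sub i3 i2, e]
    _ = _ := by
        refine integral_congr_ae (Eventually.of_forall fun z => ?_)
        simp only
        ring

lemma IsSource.integrable_prod_kernel {h : ℝ → ℝ} (hh : IsSource h) :
    Integrable (fun p : ℝ × ℝ => 1 / 2 * (greenG p.1 (-p.2) - greenG p.1 p.2) * h p.2)
      (volume.prod volume) := by
  have i1 : Integrable (fun p : ℝ × ℝ => greenG p.1 (-p.2) * h p.2) (volume.prod volume) := by
    have hp : MeasurePreserving (Prod.map id Neg.neg : ℝ × ℝ → ℝ × ℝ) (volume.prod volume)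
        (volume.prod volume) :=
      (MeasurePreserving.id volume).prod (Measure.measurePreserving_neg volume)
    simpa [Function.comp_def] using hp.integrable_comp_of_integrable hh.comp_neg.integrable_prod
  refine ((i1.sub hh.integrable_prod).const_mul (1 / 2)).congr (Eventually.of_forall fun p => ?_)
  simp only [Pi.sub_apply]
  ring

lemma potential_eq_zero (h : ℝ → ℝ) {x : ℝ} (hx : x ∉ Ioo (-1 : ℝ) 1) : potential h x = 0 := by
  rw [potential, if_neg hx]

lemma greeng_eq_zero_of_left {x : ℝ} (hx : x ∉ Ioo (-1 : ℝ) 1) (z : ℝ) : greeng x z = 0 := by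
  simp [greeng, greenG_eq_zero_of_left hx]

lemma potential_eq_setIntegral (h : ℝ → ℝ) (x : ℝ) :
    potential h x = ∫ z in Ioo (-1 : ℝ) 1, greeng x z * h z := by
  by_cases hx : x ∈ Ioo (-1 : ℝ) 1
  · rw [potential, if_pos hx]
  · simp [potential_eq_zero h hx, greeng_eq_zero_of_left hx]

lemma potential_eq_integral {h : ℝ → ℝ} (hh : IsSource h) (x : ℝ) :
    potential h x = ∫ t in (-1 : ℝ)..x, greenPotential (velocityDensity h) t := by
  -- on `[-1,1]` the identity is Fubini's theorem
  have key : ∀ x ∈ Icc (-1 : ℝ) 1,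
      potential h x = ∫ t in (-1 : ℝ)..x, greenPotential (velocityDensity h) t := by
    intro x hx
    have hi : Integrable (Function.uncurry fun t z : ℝ =>
        1 / 2 * (greenG t (-z) - greenG t z) * h z)
        ((volume.restrict (Ioc (-1) x)).prod (volume.restrict (Ioo (-1 : ℝ) 1))) := by
      rw [Measure.prod_restrict]
      exact hh.integrable_prod_kernel.integrableOn
    calc potential h x
        = ∫ z in Ioo (-1 : ℝ) 1, ∫ t in Ioc (-1) x,
            1 / 2 * (greenG t (-z) - greenG t z) * h z := by
          rw [potential_eq_setIntegral]
          refine setIntegral_congr_fun measurableSet_Ioo fun z hz => ?_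
          rw [greeng_eq_integral hx hz, intervalIntegral.integral_of_le hx.1, integral_mul_const]
      _ = ∫ t in Ioc (-1) x, ∫ z in Ioo (-1 : ℝ) 1,
            1 / 2 * (greenG t (-z) - greenG t z) * h z := (integral_integral_swap hi).symm
      _ = ∫ t in (-1 : ℝ)..x, greenPotential (velocityDensity h) t := by
          rw [intervalIntegral.integral_of_le hx.1]
          refine integral_congr_ae (Eventually.of_forall fun t => ?_)
          simp only
          rw [greenPotential_velocityDensity hh]
          refine setIntegral_eq_integral_of_forall_compl_eq_zero fun z hz => ?_
          rw [greenG_eq_zero_of_right hz, greenG_eq_zero_of_right (mt neg_mem_Ioo_iff.1 hz)]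
          simp
  by_cases hx : x ∈ Icc (-1 : ℝ) 1
  · exact key x hx
  have hx' : x ∉ Ioo (-1 : ℝ) 1 := fun h => hx (Ioo_subset_Icc_self h)
  have hint := hh.velocityDensity.integrable_greenPotential
  rw [potential_eq_zero h hx']
  rcases lt_or_ge x (-1) with hlt | hge
  · refine (intervalIntegral.integral_zero_ae (Eventually.of_forall fun t ht => ?_)).symm
    rw [uIoc_of_ge hlt.le] at ht
    exact greenPotential_eq_zero _ fun h => absurd h.1 (not_lt.2 ht.2)
  · have hgt : 1 < x := by
      by_contra! hle
      exact hx ⟨hge, hle⟩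
    have h1 := key 1 (by simp)
    rw [potential_eq_zero h (by simp)] at h1
    rw [← intervalIntegral.integral_add_adjacent_intervals (b := 1) hint.intervalIntegrable
      hint.intervalIntegrable, ← h1, zero_add]
    refine (intervalIntegral.integral_zero_ae (Eventually.of_forall fun t ht => ?_)).symm
    rw [uIoc_of_le hgt.le] at ht
    exact greenPotential_eq_zero _ fun h => absurd h.2 (not_lt.2 ht.1.le)

lemma continuous_potential {h : ℝ → ℝ} (hh : IsSource h) : Continuous (potential h) := by
  rw [funext (potential_eq_integral hh)]
  exact intervalIntegral.continuous_primitive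
    (fun _ _ => hh.velocityDensity.integrable_greenPotential.intervalIntegrable) _

lemma hasDerivAt_potential {h : ℝ → ℝ} (hh : IsSource h) {x : ℝ} (h1 : x ≠ -1) (h2 : x ≠ 1) :
    HasDerivAt (potential h) (greenPotential (velocityDensity h) x) x := by
  have hint := hh.velocityDensity.integrable_greenPotential
  rw [funext (potential_eq_integral hh)]
  refine intervalIntegral.integral_hasDerivAt_right hint.intervalIntegrable
    (hint.aestronglyMeasurable.stronglyMeasurableAtFilter) ?_
  by_cases hx : x ∈ Ioo (-1 : ℝ) 1
  · exact hh.velocityDensity.continuousOn_greenPotential.continuousAt (isOpen_Ioo.mem_nhds hx)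
  · have hx' : x ∈ (Icc (-1 : ℝ) 1)ᶜ := fun h =>
      hx ⟨lt_of_le_of_ne h.1 h1.symm, lt_of_le_of_ne h.2 h2⟩
    refine ContinuousAt.congr (continuousAt_const (y := (0 : ℝ)))
      (eventually_of_mem (isClosed_Icc.isOpen_compl.mem_nhds hx') fun t ht => ?_)
    exact (greenPotential_eq_zero _ fun h => ht (Ioo_subset_Icc_self h)).symm

lemma contDiffOn_potential {h : ℝ → ℝ} (hh : IsSource h) :
    ContDiffOn ℝ 1 (potential h) (Ioo (-1) 1) := by
  have hd : ∀ x ∈ Ioo (-1 : ℝ) 1,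
      HasDerivAt (potential h) (greenPotential (velocityDensity h) x) x :=
    fun x hx => hasDerivAt_potential hh hx.1.ne' hx.2.ne
  rw [← zero_add (1 : WithTop ℕ∞), contDiffOn_succ_iff_deriv_of_isOpen isOpen_Ioo]
  refine ⟨fun x hx => (hd x hx).differentiableAt.differentiableWithinAt, by simp, ?_⟩
  rw [contDiffOn_zero]
  exact hh.velocityDensity.continuousOn_greenPotential.congr fun x hx => (hd x hx).deriv

lemma ae_deriv_potential {h : ℝ → ℝ} (hh : IsSource h) :
    deriv (potential h) =ᵐ[volume] greenPotential (velocityDensity h) := by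
  have h1 : ∀ᵐ x : ℝ, x ≠ -1 := by simp [ae_iff, measure_singleton]
  have h2 : ∀ᵐ x : ℝ, x ≠ 1 := by simp [ae_iff, measure_singleton]
  filter_upwards [h1, h2] with x hx1 hx2
  exact (hasDerivAt_potential hh hx1 hx2).deriv

lemma integrable_deriv_potential {h : ℝ → ℝ} (hh : IsSource h) :
    Integrable (deriv (potential h)) :=
  hh.velocityDensity.integrable_greenPotential.congr (ae_deriv_potential hh).symm

lemma integrable_potential {h : ℝ → ℝ} (hh : IsSource h) : Integrable (potential h) :=
  (continuous_potential hh).integrable_of_hasCompactSupport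
    (HasCompactSupport.intro (isCompact_Icc (a := (-1 : ℝ)) (b := 1)) fun _ hx =>
      potential_eq_zero h fun h' => hx (Ioo_subset_Icc_self h'))

/-- Integration by parts against an arbitrary `C¹` function: the potential is absolutely
continuous and vanishes off `(-1,1)`. -/
lemma integral_deriv_mul_potential {h : ℝ → ℝ} (hh : IsSource h) {φ φ' : ℝ → ℂ}
    (hφ : ∀ x, HasDerivAt φ (φ' x) x) (hφ' : Continuous φ') :
    ∫ x, φ' x * (potential h x : ℂ) = -∫ x, φ x * ((deriv (potential h) x : ℝ) : ℂ) := by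
  set U := potential h with hU
  set V := greenPotential (velocityDensity h) with hV
  have hVi : Integrable V := hh.velocityDensity.integrable_greenPotential
  have hφc : Continuous φ := continuous_iff_continuousAt.2 fun x => (hφ x).continuousAt
  have hUc : Continuous (fun x => (U x : ℂ)) := by
    have := continuous_potential hh
    fun_prop
  have i1 : IntervalIntegrable (fun x => φ' x * (U x : ℂ)) volume (-2) 2 :=
    (hφ'.mul hUc).intervalIntegrable _ _
  have i2 : IntervalIntegrable (fun x => φ x * (V x : ℂ)) volume (-2) 2 :=
    (hVi.ofReal (𝕜 := ℂ)).intervalIntegrable.continuousOn_mul hφc.continuousOn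
  have e := integral_eq_of_hasDerivAt_off_countable_of_le (fun x => φ x * (U x : ℂ))
    (fun x => φ' x * (U x : ℂ) + φ x * (V x : ℂ)) (show (-2 : ℝ) ≤ 2 by norm_num)
    (s := {-1, 1}) (Set.to_countable _) (hφc.mul hUc).continuousOn
    (fun x hx => by
      simp only [Set.mem_sdiff, mem_insert_iff, mem_singleton_iff, not_or] at hx
      exact (hφ x).mul (hasDerivAt_potential hh hx.2.1 hx.2.2).ofReal_comp)
    (i1.add i2)
  have z1 : U 2 = 0 := potential_eq_zero h (by norm_num)
  have z2 : U (-2) = 0 := potential_eq_zero h (by norm_num)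
  rw [intervalIntegral.integral_add i1 i2] at e
  simp only [z1, z2, Complex.ofReal_zero, mul_zero, sub_zero] at e
  have s : ∀ F : ℝ → ℂ, (∀ x ∉ Ioo (-1 : ℝ) 1, F x = 0) → ∫ x in (-2 : ℝ)..2, F x = ∫ x, F x := by
    intro F hF
    rw [intervalIntegral.integral_of_le (by norm_num)]
    refine setIntegral_eq_integral_of_forall_compl_eq_zero fun x hx => hF x fun h' => hx ?_
    exact ⟨by linarith [h'.1], by linarith [h'.2]⟩
  rw [s _ fun x hx => by rw [hU, potential_eq_zero h hx]; simp,
    s _ fun x hx => by rw [hV, greenPotential_eq_zero _ hx]; simp] at e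
  rw [eq_neg_of_add_eq_zero_left e]
  congr 1
  refine integral_congr_ae ?_
  filter_upwards [ae_deriv_potential hh] with x hx
  rw [hx]

/-! ### Densities bounded by a power of `1 - z²` -/

lemma integrableOn_one_sub_sq_rpow {b : ℝ} (hb : -1 < b) :
    IntegrableOn (fun z : ℝ => (1 - z ^ 2) ^ b) (Ioo (-1) 1) := by
  have i0 : IntervalIntegrable (fun x : ℝ => x ^ b) volume 0 2 :=
    intervalIntegral.intervalIntegrable_rpow' hb
  have i1 : IntervalIntegrable (fun z : ℝ => (1 - z) ^ b) volume (-1) 1 := by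
    have := i0.comp_sub_left 1
    norm_num at this
    exact this.symm
  have i2 : IntervalIntegrable (fun z : ℝ => (1 + z) ^ b) volume (-1) 1 := by
    have := i0.comp_add_left 1
    norm_num at this
    exact this
  rw [intervalIntegrable_iff_integrableOn_Ioo_of_le (by norm_num)] at i1 i2
  have i3 : IntegrableOn (fun _ : ℝ => (1 : ℝ)) (Ioo (-1) 1) := by simp
  refine ((i3.add i1).add i2).mono'
    (Measurable.aestronglyMeasurable (by fun_prop)) ?_
  filter_upwards [ae_restrict_mem measurableSet_Ioo] with z hz
  have h0 := one_sub_sq_pos hz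
  have hz1 : 0 < 1 - z := by linarith [hz.2]
  have hz2 : 0 < 1 + z := by linarith [hz.1]
  rw [Real.norm_of_nonneg (Real.rpow_nonneg h0.le b)]
  simp only [Pi.add_apply]
  have p1 := Real.rpow_pos_of_pos hz1 b
  have p2 := Real.rpow_pos_of_pos hz2 b
  rcases le_total 0 b with hb0 | hb0
  · have := Real.rpow_le_one h0.le (by nlinarith [sq_nonneg z]) hb0
    linarith
  · rw [show 1 - z ^ 2 = (1 - z) * (1 + z) by ring, Real.mul_rpow hz1.le hz2.le]
    rcases le_total 0 z with hz0 | hz0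
    · have := Real.rpow_le_one_of_one_le_of_nonpos (show 1 ≤ 1 + z by linarith) hb0
      nlinarith
    · have := Real.rpow_le_one_of_one_le_of_nonpos (show 1 ≤ 1 - z by linarith) hb0
      nlinarith

lemma sqrt_mul_rpow {a z : ℝ} (hz : z ∈ Ioo (-1 : ℝ) 1) :
    √(1 - z ^ 2) * (1 - z ^ 2) ^ a = (1 - z ^ 2) ^ (a + 1 / 2) := by
  rw [Real.sqrt_eq_rpow, ← Real.rpow_add (one_sub_sq_pos hz), add_comm]

lemma isSource_indicator {a Cf : ℝ} (ha : -3 / 2 < a) {f : ℝ → ℝ}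
    (hf : AEStronglyMeasurable f (volume.restrict (Ioo (-1 : ℝ) 1)))
    (hb : ∀ z ∈ Ioo (-1 : ℝ) 1, |f z| ≤ Cf * (1 - z ^ 2) ^ a) :
    IsSource ((Ioo (-1 : ℝ) 1).indicator f) where
  aestronglyMeasurable := (aestronglyMeasurable_indicator_iff measurableSet_Ioo).2 hf
  integrable := by
    have h1 : IntegrableOn (fun z => √(1 - z ^ 2) * f z) (Ioo (-1) 1) := by
      refine ((integrableOn_one_sub_sq_rpow (b := a + 1 / 2) (by linarith)).const_mul Cf).mono'
        ((by fun_prop : Continuous fun z : ℝ => √(1 - z ^ 2)).aestronglyMeasurable.mul hf) ?_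
      filter_upwards [ae_restrict_mem measurableSet_Ioo] with z hz
      rw [norm_mul, Real.norm_of_nonneg (Real.sqrt_nonneg _), Real.norm_eq_abs,
        ← sqrt_mul_rpow hz]
      have := mul_le_mul_of_nonneg_left (hb z hz) (Real.sqrt_nonneg (1 - z ^ 2))
      linarith
    refine ((integrable_indicator_iff measurableSet_Ioo).2 h1).congr
      (Eventually.of_forall fun z => ?_)
    simp [indicator_apply]
  bounded r hr := by
    have hc : ContinuousOn (fun z : ℝ => Cf * (1 - z ^ 2) ^ a) (Icc (-r) r) := by
      refine continuousOn_const.mul (ContinuousOn.rpow_const (by fun_prop) fun z hz => Or.inl ?_)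
      exact (one_sub_sq_pos ⟨by linarith [hz.1], by linarith [hz.2]⟩).ne'
    obtain ⟨M, hM⟩ := isCompact_Icc.exists_bound_of_continuousOn hc
    refine ⟨M, fun z hz => ?_⟩
    have hz' := abs_le.1 hz
    have hz1 : z ∈ Ioo (-1 : ℝ) 1 := ⟨by linarith [hz'.1], by linarith [hz'.2]⟩
    rw [indicator_of_mem hz1]
    exact (hb z hz1).trans ((le_abs_self _).trans (hM z hz'))

lemma abs_greeng_mul_le {a Cf : ℝ} {f : ℝ → ℝ}
    (hb : ∀ z ∈ Ioo (-1 : ℝ) 1, |f z| ≤ Cf * (1 - z ^ 2) ^ a) (x : ℝ) {z : ℝ}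
    (hz : z ∈ Ioo (-1 : ℝ) 1) :
    ‖greeng x z * f z‖ ≤ Real.pi⁻¹ * √(1 - x ^ 2) * Cf * (1 - z ^ 2) ^ (a + 1 / 2) := by
  rw [norm_mul, Real.norm_eq_abs, Real.norm_eq_abs, ← sqrt_mul_rpow hz]
  have := mul_le_mul (abs_greeng_le x z) (hb z hz) (abs_nonneg _) (by positivity)
  linarith

lemma integrableOn_greeng_mul {a Cf : ℝ} (ha : -3 / 2 < a) {f : ℝ → ℝ}
    (hf : AEStronglyMeasurable f (volume.restrict (Ioo (-1 : ℝ) 1)))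
    (hb : ∀ z ∈ Ioo (-1 : ℝ) 1, |f z| ≤ Cf * (1 - z ^ 2) ^ a) (x : ℝ) :
    IntegrableOn (fun z => greeng x z * f z) (Ioo (-1) 1) := by
  have hg : Measurable (fun z => greeng x z) :=
    measurable_greeng.comp (measurable_const.prodMk measurable_id)
  refine ((integrableOn_one_sub_sq_rpow (b := a + 1 / 2) (by linarith)).const_mul
    (Real.pi⁻¹ * √(1 - x ^ 2) * Cf)).mono' (hg.aestronglyMeasurable.mul hf) ?_
  filter_upwards [ae_restrict_mem measurableSet_Ioo] with z hz
  exact abs_greeng_mul_le hb x hz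

lemma abs_potential_le {a Cf : ℝ} (ha : -3 / 2 < a) {f : ℝ → ℝ}
    (hb : ∀ z ∈ Ioo (-1 : ℝ) 1, |f z| ≤ Cf * (1 - z ^ 2) ^ a) (x : ℝ) :
    |potential f x| ≤
      (Real.pi⁻¹ * ∫ z in Ioo (-1 : ℝ) 1, (1 - z ^ 2) ^ (a + 1 / 2)) * Cf * √(1 - x ^ 2) := by
  rw [potential_eq_setIntegral, ← Real.norm_eq_abs]
  refine (norm_integral_le_of_norm_le
    ((integrableOn_one_sub_sq_rpow (b := a + 1 / 2) (by linarith)).const_mul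
      (Real.pi⁻¹ * √(1 - x ^ 2) * Cf)) ?_).trans_eq ?_
  · filter_upwards [ae_restrict_mem measurableSet_Ioo] with z hz
    exact abs_greeng_mul_le hb x hz
  · rw [integral_const_mul]
    ring

lemma potential_indicator (f : ℝ → ℝ) :
    potential ((Ioo (-1 : ℝ) 1).indicator f) = potential f := by
  funext x
  rw [potential_eq_setIntegral, potential_eq_setIntegral]
  exact setIntegral_congr_fun measurableSet_Ioo fun z hz => by simp only [indicator_of_mem hz]

/-! ### Logarithmic integrals of Chebyshev polynomials -/

lemma intervalIntegrable_log_sin_half (c a b : ℝ) :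
    IntervalIntegrable (fun t => Real.log (Real.sin ((t + c) / 2))) volume a b := by
  have h : MeromorphicOn (fun t : ℝ => Real.sin ((t + c) / 2)) (uIcc a b) := by
    refine AnalyticOnNhd.meromorphicOn fun t _ => ?_
    fun_prop
  exact h.intervalIntegrable_log

lemma intervalIntegrable_log_sub (y a b : ℝ) :
    IntervalIntegrable (fun t => Real.log (t - y)) volume a b := by
  have h : MeromorphicOn (fun t : ℝ => t - y) (uIcc a b) := by
    refine AnalyticOnNhd.meromorphicOn fun t _ => ?_
    fun_prop
  exact h.intervalIntegrable_log

/-- The `n`-th Fourier cosine moment of `log |sin(t/2)|`, where `Real.log` supplies the absolute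
value. -/
def logSinMoment (n : ℤ) : ℝ :=
  ∫ t in -Real.pi..Real.pi, Real.log (Real.sin (t / 2)) * Real.cos (n * t)

lemma integral_cos_int_mul {n : ℤ} (hn : n ≠ 0) :
    ∫ t in -Real.pi..Real.pi, Real.cos (n * t) = 0 := by
  have hn' : (n : ℝ) ≠ 0 := Int.cast_ne_zero.2 hn
  rw [intervalIntegral.integral_comp_mul_left _ hn', integral_cos]
  simp [Real.sin_int_mul_pi]

lemma integral_one_add_cos_mul_U (k : ℕ) :
    ∫ t in -Real.pi..Real.pi, (1 + Real.cos t) * (Chebyshev.U ℝ k).eval (Real.cos t)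
      = 2 * Real.pi := by
  induction k with
  | zero =>
    simp only [Nat.cast_zero, Polynomial.Chebyshev.U_zero, Polynomial.eval_one, mul_one]
    rw [intervalIntegral.integral_add (by simp) (Real.continuous_cos.intervalIntegrable _ _)]
    simp
    ring
  | succ k ih =>
    have h : ∀ t : ℝ, (1 + Real.cos t) * (Chebyshev.U ℝ (k + 1 : ℕ)).eval (Real.cos t) =
        (1 + Real.cos t) * (Chebyshev.U ℝ k).eval (Real.cos t) +
          (Real.cos ((k + 1 : ℤ) * t) + Real.cos ((k + 2 : ℤ) * t)) := by
      intro t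
      rw [← Polynomial.Chebyshev.T_real_cos, ← Polynomial.Chebyshev.T_real_cos,
        Polynomial.Chebyshev.T_eq_X_mul_U_sub_U]
      have h1 := congrArg (Polynomial.eval (Real.cos t))
        (Polynomial.Chebyshev.U_eq_X_mul_U_add_T ℝ (k : ℤ))
      simp only [Polynomial.eval_add, Polynomial.eval_mul, Polynomial.eval_X,
        Polynomial.eval_sub] at h1 ⊢
      push_cast
      linear_combination h1
    simp_rw [h]
    have c1 : ∀ n : ℤ, IntervalIntegrable (fun t : ℝ => Real.cos (n * t)) volume (-Real.pi)
        Real.pi := fun n => Continuous.intervalIntegrable (by fun_prop) _ _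
    rw [intervalIntegral.integral_add (Continuous.intervalIntegrable (by fun_prop) _ _)
      ((c1 _).add (c1 _)), intervalIntegral.integral_add (c1 _) (c1 _), ih,
      integral_cos_int_mul (by lia), integral_cos_int_mul (by lia)]
    ring

/-- Integration by parts reduces the moment to the integral of `(1 + cos t) U_k(cos t)`. -/
lemma logSinMoment_succ (k : ℕ) : ((k : ℝ) + 1) * logSinMoment (k + 1) = -Real.pi := by
  have hid : ∀ t : ℝ, Real.sin ((k + 1 : ℤ) * t) =
      Real.sin (t / 2) * (2 * Real.cos (t / 2) * (Chebyshev.U ℝ k).eval (Real.cos t)) := by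
    intro t
    have h := Polynomial.Chebyshev.U_real_cos t k
    have h2 : Real.sin t = 2 * Real.sin (t / 2) * Real.cos (t / 2) := by
      rw [← Real.sin_two_mul]; congr 1; ring
    push_cast at h ⊢
    rw [← h, h2]
    ring
  -- at `t = 0` the zero of the sine absorbs the logarithm
  have hcont : Continuous
      (fun t : ℝ => Real.log (Real.sin (t / 2)) * Real.sin ((k + 1 : ℤ) * t)) := by
    have h := (Real.continuous_mul_log.comp (by fun_prop : Continuous fun t : ℝ =>
      Real.sin (t / 2))).mul (by fun_prop : Continuous fun t : ℝ => 2 * Real.cos (t / 2) *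
        (Chebyshev.U ℝ k).eval (Real.cos t))
    refine h.congr fun t => ?_
    rw [hid]
    change Real.sin (t / 2) * Real.log (Real.sin (t / 2)) *
      (2 * Real.cos (t / 2) * (Chebyshev.U ℝ k).eval (Real.cos t)) = _
    ring
  have i1 : IntervalIntegrable (fun t : ℝ => Real.log (Real.sin (t / 2)) *
      Real.cos ((k + 1 : ℤ) * t)) volume (-Real.pi) Real.pi := by
    have := intervalIntegrable_log_sin_half 0 (-Real.pi) Real.pi
    simp only [add_zero] at this
    exact this.mul_continuousOn (by fun_prop)
  have i2 : IntervalIntegrable (fun t : ℝ => (1 + Real.cos t) * (Chebyshev.U ℝ k).eval (Real.cos t))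
      volume (-Real.pi) Real.pi := Continuous.intervalIntegrable (by fun_prop) _ _
  have e := integral_eq_of_hasDerivAt_off_countable_of_le
    (fun t : ℝ => Real.log (Real.sin (t / 2)) * Real.sin ((k + 1 : ℤ) * t))
    (fun t => ((k : ℝ) + 1) * (Real.log (Real.sin (t / 2)) * Real.cos ((k + 1 : ℤ) * t)) +
      1 / 2 * ((1 + Real.cos t) * (Chebyshev.U ℝ k).eval (Real.cos t)))
    (show -Real.pi ≤ Real.pi by linarith [Real.pi_pos])
    (s := {0}) (Set.to_countable _) hcont.continuousOn
    (fun t ht => by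
      have ht0 : t ≠ 0 := ht.2
      have hs : Real.sin (t / 2) ≠ 0 := by
        rw [Ne, Real.sin_eq_zero_iff_of_lt_of_lt (by linarith [ht.1.1, Real.pi_pos])
          (by linarith [ht.1.2, Real.pi_pos])]
        intro h
        exact ht0 (by linarith)
      have h1 := (((hasDerivAt_id t).div_const 2).sin).log hs
      have h2 := ((hasDerivAt_id t).const_mul ((k + 1 : ℤ) : ℝ)).sin
      refine (h1.mul h2).congr_deriv ?_
      simp only [id]
      rw [hid, show 1 + Real.cos t = 2 * Real.cos (t / 2) ^ 2 by
        rw [Real.cos_sq]; ring_nf]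
      push_cast
      field_simp
      ring)
    ((i1.const_mul _).add (i2.const_mul _))
  rw [intervalIntegral.integral_add (i1.const_mul _) (i2.const_mul _),
    intervalIntegral.integral_const_mul, intervalIntegral.integral_const_mul,
    integral_one_add_cos_mul_U] at e
  simp only [mul_neg, Real.sin_neg, Real.sin_int_mul_pi] at e
  have e' : ((k : ℝ) + 1) * logSinMoment (k + 1) =
    (k + 1) * ∫ t in -Real.pi..Real.pi, Real.log (Real.sin (t / 2)) * Real.cos ((k + 1 : ℤ) * t) :=
    rfl
  rw [e']
  linarith

lemma integral_odd_eq_zero {F : ℝ → ℝ} (hF : ∀ t, F (-t) = -F t) (a : ℝ) :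
    ∫ t in -a..a, F t = 0 := by
  have h := intervalIntegral.integral_comp_neg (f := F) (a := -a) (b := a)
  simp_rw [hF, intervalIntegral.integral_neg, neg_neg] at h
  linarith

lemma log_sin_half_neg (t : ℝ) : Real.log (Real.sin (-t / 2)) = Real.log (Real.sin (t / 2)) := by
  rw [neg_div, Real.sin_neg, Real.log_neg_eq_log]

lemma intervalIntegrable_log_sin_half_mul {g : ℝ → ℝ} (hg : Continuous g) (c a b : ℝ) :
    IntervalIntegrable (fun t => Real.log (Real.sin ((t + c) / 2)) * g t) volume a b :=
  (intervalIntegrable_log_sin_half c a b).mul_continuousOn hg.continuousOn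

/-- Translation of a period: the integrand may be shifted by `η`. -/
lemma integral_log_sin_half_sub_mul {g : ℝ → ℝ} (hg : Function.Periodic g (2 * Real.pi)) (η : ℝ) :
    ∫ θ in -Real.pi..Real.pi, Real.log (Real.sin ((θ + -η) / 2)) * g θ =
      ∫ θ in -Real.pi..Real.pi, Real.log (Real.sin (θ / 2)) * g (θ + η) := by
  have hp : Function.Periodic (fun θ => Real.log (Real.sin (θ / 2)) * g (θ + η)) (2 * Real.pi) := by
    intro θ
    simp only
    rw [show (θ + 2 * Real.pi) / 2 = θ / 2 + Real.pi by ring, Real.sin_add_pi,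
      Real.log_neg_eq_log, show θ + 2 * Real.pi + η = θ + η + 2 * Real.pi by ring, hg]
  have h1 := hp.intervalIntegral_add_eq (-Real.pi) (-Real.pi + -η)
  have h2 := intervalIntegral.integral_comp_add_right
    (fun θ => Real.log (Real.sin (θ / 2)) * g (θ + η)) (a := -Real.pi) (b := Real.pi) (-η)
  simp only [neg_add_cancel_right] at h2
  rw [h2, show Real.pi = -Real.pi + 2 * Real.pi by ring]
  convert! h1.symm using 2 <;> ring

lemma periodic_cos_int_mul (n : ℤ) :
    Function.Periodic (fun t : ℝ => Real.cos (n * t)) (2 * Real.pi) := by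
  intro t
  simp only
  rw [mul_add, Real.cos_add_int_mul_two_pi]

lemma periodic_sin_int_mul (n : ℤ) :
    Function.Periodic (fun t : ℝ => Real.sin (n * t)) (2 * Real.pi) := by
  intro t
  simp only
  rw [mul_add, Real.sin_add_int_mul_two_pi]

lemma integral_log_sin_half_mul_sin (n : ℤ) :
    ∫ θ in -Real.pi..Real.pi, Real.log (Real.sin (θ / 2)) * Real.sin (n * θ) = 0 := by
  refine integral_odd_eq_zero (fun t => ?_) _
  rw [log_sin_half_neg, mul_neg, Real.sin_neg, mul_neg]

lemma integral_log_sin_half_sub_mul_cos (n : ℤ) (η : ℝ) :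
    ∫ θ in -Real.pi..Real.pi, Real.log (Real.sin ((θ + -η) / 2)) * Real.cos (n * θ) =
      Real.cos (n * η) * logSinMoment n := by
  have i1 := intervalIntegrable_log_sin_half_mul (g := fun t => Real.cos (n * t)) (by fun_prop) 0
    (-Real.pi) Real.pi
  have i2 := intervalIntegrable_log_sin_half_mul (g := fun t => Real.sin (n * t)) (by fun_prop) 0
    (-Real.pi) Real.pi
  simp only [add_zero] at i1 i2
  rw [integral_log_sin_half_sub_mul (periodic_cos_int_mul n)]
  have : ∀ θ, Real.log (Real.sin (θ / 2)) * Real.cos (n * (θ + η)) =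
      Real.cos (n * η) * (Real.log (Real.sin (θ / 2)) * Real.cos (n * θ)) -
        Real.sin (n * η) * (Real.log (Real.sin (θ / 2)) * Real.sin (n * θ)) := by
    intro θ
    rw [mul_add, Real.cos_add]
    ring
  simp_rw [this]
  rw [intervalIntegral.integral_sub (i1.const_mul _) (i2.const_mul _),
    intervalIntegral.integral_const_mul, intervalIntegral.integral_const_mul,
    integral_log_sin_half_mul_sin, logSinMoment, mul_zero, sub_zero]

lemma integral_log_sin_half_sub_mul_sin (n : ℤ) (η : ℝ) :
    ∫ θ in -Real.pi..Real.pi, Real.log (Real.sin ((θ + -η) / 2)) * Real.sin (n * θ) =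
      Real.sin (n * η) * logSinMoment n := by
  have i1 := intervalIntegrable_log_sin_half_mul (g := fun t => Real.cos (n * t)) (by fun_prop) 0
    (-Real.pi) Real.pi
  have i2 := intervalIntegrable_log_sin_half_mul (g := fun t => Real.sin (n * t)) (by fun_prop) 0
    (-Real.pi) Real.pi
  simp only [add_zero] at i1 i2
  rw [integral_log_sin_half_sub_mul (periodic_sin_int_mul n)]
  have : ∀ θ, Real.log (Real.sin (θ / 2)) * Real.sin (n * (θ + η)) =
      Real.cos (n * η) * (Real.log (Real.sin (θ / 2)) * Real.sin (n * θ)) +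
        Real.sin (n * η) * (Real.log (Real.sin (θ / 2)) * Real.cos (n * θ)) := by
    intro θ
    rw [mul_add, Real.sin_add]
    ring
  simp_rw [this]
  rw [intervalIntegral.integral_add (i2.const_mul _) (i1.const_mul _),
    intervalIntegral.integral_const_mul, intervalIntegral.integral_const_mul,
    integral_log_sin_half_mul_sin, logSinMoment, mul_zero, zero_add]

/-- Reflection `θ ↦ -θ` of the half period. -/
lemma integral_log_sin_half_add_mul (g : ℝ → ℝ) (η : ℝ) :
    ∫ θ in (0 : ℝ)..Real.pi, Real.log (Real.sin ((θ + η) / 2)) * g θ =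
      ∫ θ in -Real.pi..0, Real.log (Real.sin ((θ + -η) / 2)) * g (-θ) := by
  have h := intervalIntegral.integral_comp_neg (a := 0) (b := Real.pi)
    (f := fun θ => Real.log (Real.sin ((θ + -η) / 2)) * g (-θ))
  rw [neg_zero] at h
  rw [← h]
  refine intervalIntegral.integral_congr fun θ _ => ?_
  simp only [neg_neg]
  rw [← log_sin_half_neg]
  congr 4
  ring

lemma sin_half_add_pos {θ η : ℝ} (hθ : θ ∈ Ioo 0 Real.pi) (hη : η ∈ Ioo 0 Real.pi) :
    0 < Real.sin ((θ + η) / 2) :=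
  Real.sin_pos_of_pos_of_lt_pi (by linarith [hθ.1, hη.1]) (by linarith [hθ.2, hη.2])

lemma sin_half_sub_ne_zero {θ η : ℝ} (hθ : θ ∈ Ioo 0 Real.pi) (hη : η ∈ Ioo 0 Real.pi)
    (h : θ ≠ η) : Real.sin ((θ + -η) / 2) ≠ 0 := by
  rw [Ne, Real.sin_eq_zero_iff_of_lt_of_lt (by linarith [hθ.1, hη.2, Real.pi_pos])
    (by linarith [hθ.2, hη.1, Real.pi_pos])]
  intro h'
  exact h (by linarith)

lemma cos_sub_cos_eq (θ η : ℝ) : Real.cos θ - Real.cos η =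
    -(2 * Real.sin ((θ + η) / 2) * Real.sin ((θ + -η) / 2)) := by
  rw [Real.cos_sub_cos, ← sub_eq_add_neg]
  ring

lemma log_cos_sub_cos {θ η : ℝ} (hθ : θ ∈ Ioo 0 Real.pi) (hη : η ∈ Ioo 0 Real.pi) (h : θ ≠ η) :
    Real.log (Real.cos θ - Real.cos η) = Real.log 2 + Real.log (Real.sin ((θ + η) / 2)) +
      Real.log (Real.sin ((θ + -η) / 2)) := by
  rw [cos_sub_cos_eq, Real.log_neg_eq_log, Real.log_mul
    (mul_ne_zero two_ne_zero (sin_half_add_pos hθ hη).ne') (sin_half_sub_ne_zero hθ hη h),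
    Real.log_mul two_ne_zero (sin_half_add_pos hθ hη).ne']

lemma greenG_cos_cos {θ η : ℝ} (hθ : θ ∈ Ioo 0 Real.pi) (hη : η ∈ Ioo 0 Real.pi) (h : θ ≠ η) :
    greenG (Real.cos η) (Real.cos θ) = Real.pi⁻¹ * (Real.log (Real.sin ((θ + η) / 2)) -
      Real.log (Real.sin ((θ + -η) / 2))) := by
  have hp := sin_half_add_pos hθ hη
  have hn := sin_half_sub_ne_zero hθ hη h
  have hm : ∀ t ∈ Ioo 0 Real.pi, Real.cos t ∈ Ioo (-1 : ℝ) 1 := by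
    intro t ht
    have h1 := Real.sin_sq_add_cos_sq t
    have h2 := Real.sin_pos_of_pos_of_lt_pi ht.1 ht.2
    exact abs_lt.1 ((sq_lt_one_iff_abs_lt_one _).1 (by nlinarith))
  have hs : ∀ t ∈ Ioo 0 Real.pi, √(1 - Real.cos t ^ 2) = Real.sin t := by
    intro t ht
    rw [← Real.sin_sq, Real.sqrt_sq (Real.sin_pos_of_pos_of_lt_pi ht.1 ht.2).le]
  rw [greenG_eq_div (hm θ hθ), hs θ hθ, hs η hη, cos_sub_cos_eq]
  congr 1
  rw [← Real.log_abs (Real.sin ((θ + -η) / 2)), ← Real.log_div hp.ne' (abs_ne_zero.2 hn)]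
  set p := Real.sin ((θ + η) / 2) with hpd
  set q := Real.sin ((θ + -η) / 2) with hqd
  have hq : 0 < |q| := abs_pos.2 hn
  rw [← Real.arsinh_sinh (Real.log (p / |q|)), Real.sinh_log (by positivity)]
  congr 1
  have e1 : Real.sin η * Real.sin θ = p ^ 2 - q ^ 2 := by
    rw [hpd, hqd, Real.sin_sq_eq_half_sub, Real.sin_sq_eq_half_sub,
      show 2 * ((θ + η) / 2) = θ + η by ring, show 2 * ((θ + -η) / 2) = θ - η by ring,
      Real.cos_add, Real.cos_sub]
    ring
  rw [e1, abs_neg, abs_mul, abs_of_pos (show 0 < 2 * p by positivity), ← sq_abs q]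
  field_simp

lemma ae_ne_angle (η : ℝ) : ∀ᵐ θ : ℝ, θ ≠ η ∧ θ ≠ Real.pi := by
  have h1 : ∀ᵐ θ : ℝ, θ ≠ η := by simp [ae_iff, measure_singleton]
  have h2 : ∀ᵐ θ : ℝ, θ ≠ Real.pi := by simp [ae_iff, measure_singleton]
  exact h1.and h2

lemma mem_Ioo_of_mem_uIoc {θ : ℝ} (hθ : θ ∈ uIoc 0 Real.pi) (h : θ ≠ Real.pi) :
    θ ∈ Ioo 0 Real.pi := by
  rw [uIoc_of_le Real.pi_pos.le] at hθ
  exact ⟨hθ.1, lt_of_le_of_ne hθ.2 h⟩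

lemma integral_greenG_cos_mul_sin (n : ℤ) {η : ℝ} (hη : η ∈ Ioo 0 Real.pi) :
    ∫ θ in (0 : ℝ)..Real.pi, greenG (Real.cos η) (Real.cos θ) * Real.sin (n * θ) =
      -(Real.pi⁻¹ * (Real.sin (n * η) * logSinMoment n)) := by
  have hc : Continuous fun t : ℝ => Real.sin (n * t) := by fun_prop
  have i := intervalIntegrable_log_sin_half_mul hc
  have h1 : ∫ θ in (0 : ℝ)..Real.pi, greenG (Real.cos η) (Real.cos θ) * Real.sin (n * θ) =
      ∫ θ in (0 : ℝ)..Real.pi, Real.pi⁻¹ *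
        (Real.log (Real.sin ((θ + η) / 2)) * Real.sin (n * θ) -
          Real.log (Real.sin ((θ + -η) / 2)) * Real.sin (n * θ)) := by
    refine intervalIntegral.integral_congr_ae ?_
    filter_upwards [ae_ne_angle η] with θ hθ hm
    rw [greenG_cos_cos (mem_Ioo_of_mem_uIoc hm hθ.2) hη hθ.1]
    ring
  rw [h1, intervalIntegral.integral_const_mul, intervalIntegral.integral_sub (i _ _ _) (i _ _ _),
    integral_log_sin_half_add_mul, ← integral_log_sin_half_sub_mul_sin,
    ← intervalIntegral.integral_add_adjacent_intervals (i (-η) (-Real.pi) 0) (i (-η) 0 Real.pi)]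
  simp only [mul_neg, Real.sin_neg, intervalIntegral.integral_neg]
  ring

lemma intervalIntegrable_log_cos_sub_mul_cos (n : ℤ) {η : ℝ} (hη : η ∈ Ioo 0 Real.pi) :
    IntervalIntegrable (fun θ => Real.log (Real.cos θ - Real.cos η) * Real.cos (n * θ)) volume
      0 Real.pi := by
  have hc : Continuous fun t : ℝ => Real.cos (n * t) := by fun_prop
  have i := intervalIntegrable_log_sin_half_mul hc
  refine ((((hc.intervalIntegrable 0 Real.pi).const_mul (Real.log 2)).add (i η _ _)).add
    (i (-η) _ _)).congr_ae ?_
  rw [EventuallyEq, ae_restrict_iff' measurableSet_uIoc]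
  filter_upwards [ae_ne_angle η] with θ hθ hm
  rw [log_cos_sub_cos (mem_Ioo_of_mem_uIoc hm hθ.2) hη hθ.1]
  ring

lemma integral_log_cos_sub_mul_cos (n : ℤ) {η : ℝ} (hη : η ∈ Ioo 0 Real.pi) :
    ∫ θ in (0 : ℝ)..Real.pi, Real.log (Real.cos θ - Real.cos η) * Real.cos (n * θ) =
      Real.log 2 * (∫ θ in (0 : ℝ)..Real.pi, Real.cos (n * θ)) +
        Real.cos (n * η) * logSinMoment n := by
  have hc : Continuous fun t : ℝ => Real.cos (n * t) := by fun_prop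
  have i := intervalIntegrable_log_sin_half_mul hc
  have i0 := (hc.intervalIntegrable (μ := volume) 0 Real.pi).const_mul (Real.log 2)
  have h1 : ∫ θ in (0 : ℝ)..Real.pi, Real.log (Real.cos θ - Real.cos η) * Real.cos (n * θ) =
      ∫ θ in (0 : ℝ)..Real.pi, (Real.log 2 * Real.cos (n * θ) +
        Real.log (Real.sin ((θ + η) / 2)) * Real.cos (n * θ) +
          Real.log (Real.sin ((θ + -η) / 2)) * Real.cos (n * θ)) := by
    refine intervalIntegral.integral_congr_ae ?_
    filter_upwards [ae_ne_angle η] with θ hθ hm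
    rw [log_cos_sub_cos (mem_Ioo_of_mem_uIoc hm hθ.2) hη hθ.1]
    ring
  rw [h1, intervalIntegral.integral_add (i0.add (i _ _ _)) (i _ _ _),
    intervalIntegral.integral_add i0 (i _ _ _), intervalIntegral.integral_const_mul,
    integral_log_sin_half_add_mul, ← integral_log_sin_half_sub_mul_cos,
    ← intervalIntegral.integral_add_adjacent_intervals (i (-η) (-Real.pi) 0) (i (-η) 0 Real.pi)]
  simp only [mul_neg, Real.cos_neg]
  ring

/-- The substitution `x = cos θ`, valid for every integrand. -/
lemma integral_comp_cos_mul_sin (F : ℝ → ℝ) :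
    ∫ θ in (0 : ℝ)..Real.pi, F (Real.cos θ) * Real.sin θ = ∫ x in (-1 : ℝ)..1, F x := by
  have h := intervalIntegral.integral_comp_mul_deriv_of_deriv_nonpos (a := 0) (b := Real.pi)
    (f := Real.cos) (f' := fun θ => -Real.sin θ) (g := F) Real.continuous_cos.continuousOn
    (fun x _ => Real.hasDerivAt_cos x) (fun x hx => by
      rw [min_eq_left Real.pi_pos.le, max_eq_right Real.pi_pos.le] at hx
      linarith [Real.sin_pos_of_pos_of_lt_pi hx.1 hx.2])
  rw [Real.cos_zero, Real.cos_pi, intervalIntegral.integral_symm (-1) 1] at h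
  rw [← neg_inj, ← h, ← intervalIntegral.integral_neg]
  refine intervalIntegral.integral_congr fun θ _ => ?_
  simp

lemma integral_greenG_mul_U (k : ℕ) {x : ℝ} (hx : x ∈ Ioo (-1 : ℝ) 1) :
    ((k : ℝ) + 1) * ∫ z, greenG x z * (Chebyshev.U ℝ k).eval z =
      √(1 - x ^ 2) * (Chebyshev.U ℝ k).eval x := by
  have h0 : ∫ z, greenG x z * (Chebyshev.U ℝ k).eval z =
      ∫ z in (-1 : ℝ)..1, greenG x z * (Chebyshev.U ℝ k).eval z := by
    rw [intervalIntegral.integral_of_le (by norm_num)]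
    refine (setIntegral_eq_integral_of_forall_compl_eq_zero fun z hz => ?_).symm
    rw [greenG_eq_zero_of_right (fun h => hz (Ioo_subset_Ioc_self h)), zero_mul]
  obtain ⟨η, hη, rfl⟩ : ∃ η ∈ Ioo 0 Real.pi, Real.cos η = x :=
    ⟨Real.arccos x, ⟨Real.arccos_pos.2 hx.2, Real.arccos_lt_pi.2 hx.1⟩,
      Real.cos_arccos hx.1.le hx.2.le⟩
  have h1 := integral_greenG_cos_mul_sin (k + 1) hη
  rw [h0, ← integral_comp_cos_mul_sin, ← Real.sin_sq,
    Real.sqrt_sq (Real.sin_pos_of_pos_of_lt_pi hη.1 hη.2).le]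
  have h2 : ∀ θ : ℝ, greenG (Real.cos η) (Real.cos θ) * (Chebyshev.U ℝ k).eval (Real.cos θ) *
      Real.sin θ = greenG (Real.cos η) (Real.cos θ) * Real.sin (((k + 1 : ℤ) : ℝ) * θ) := by
    intro θ
    have := Polynomial.Chebyshev.U_real_cos θ k
    push_cast at this ⊢
    rw [← this]
    ring
  simp_rw [h2, h1]
  have h3 := Polynomial.Chebyshev.U_real_cos η k
  have h4 := logSinMoment_succ k
  push_cast at h3 ⊢
  rw [mul_comm (Real.sin η), h3]
  have := Real.pi_pos
  field_simp
  linear_combination (-Real.sin ((k + 1) * η)) * h4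

/-- The logarithmic potential of `√(1-x²) U_k(x)` is, on `(-1,1)`, a polynomial with derivative
`π T_{k+1}`. -/
lemma exists_polynomial_integral_log (k : ℕ) : ∃ W : Polynomial ℝ,
    Polynomial.derivative W = Polynomial.C Real.pi * Chebyshev.T ℝ (k + 1) ∧
    ∀ y ∈ Ioo (-1 : ℝ) 1, ∫ x in (-1 : ℝ)..1,
      √(1 - x ^ 2) * (Chebyshev.U ℝ k).eval x * Real.log (x - y) = W.eval y := by
  set c : ℝ := 1 / 2 * (Real.log 2 * (∫ θ in (0 : ℝ)..Real.pi, Real.cos ((k : ℤ) * θ)) -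
    Real.log 2 * (∫ θ in (0 : ℝ)..Real.pi, Real.cos ((k + 2 : ℤ) * θ))) with hc
  refine ⟨Polynomial.C (1 / 2 * logSinMoment k) * Chebyshev.T ℝ k -
    Polynomial.C (1 / 2 * logSinMoment (k + 2)) * Chebyshev.T ℝ (k + 2) + Polynomial.C c, ?_, ?_⟩
  · have e1 : Polynomial.C (logSinMoment (k + 2)) * Polynomial.derivative (Chebyshev.T ℝ (k + 2)) =
        -Polynomial.C Real.pi * Chebyshev.U ℝ (k + 1) := by
      have := logSinMoment_succ (k + 1)
      rw [Polynomial.Chebyshev.T_derivative_eq_U, ← Polynomial.C_neg, ← this]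
      rw [show (k : ℤ) + 2 - 1 = k + 1 by ring,
        show ((k + 1 : ℕ) : ℤ) + 1 = k + 2 by push_cast; ring,
        Polynomial.C_mul]
      simp only [Polynomial.C_add, map_natCast, map_one]
      push_cast
      ring
    have e2 : Polynomial.C (logSinMoment k) * Polynomial.derivative (Chebyshev.T ℝ k) =
        -Polynomial.C Real.pi * Chebyshev.U ℝ (k - 1) := by
      cases k with
      | zero => simp
      | succ k =>
        have := logSinMoment_succ k
        rw [Polynomial.Chebyshev.T_derivative_eq_U, ← Polynomial.C_neg, ← this, Polynomial.C_mul]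
        simp only [Polynomial.C_add, map_natCast, map_one]
        push_cast
        ring
    have e3 := Polynomial.Chebyshev.two_mul_T_eq_U_sub_U ℝ ((k : ℤ) - 1)
    rw [show (k : ℤ) - 1 + 2 = k + 1 by ring] at e3
    have e4 : (Polynomial.C (1 / 2 : ℝ)) * 2 = 1 := by
      rw [← Polynomial.C_ofNat, ← Polynomial.C_mul]; norm_num
    simp only [Polynomial.C_mul, Polynomial.derivative_add, Polynomial.derivative_sub,
      Polynomial.derivative_mul, Polynomial.derivative_C, zero_mul, zero_add, mul_zero, add_zero]
    linear_combination Polynomial.C (1 / 2 : ℝ) * e2 - Polynomial.C (1 / 2 : ℝ) * e1 -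
      Polynomial.C (1 / 2 : ℝ) * Polynomial.C Real.pi * e3 +
      Polynomial.C Real.pi * Chebyshev.T ℝ (k + 1) * e4
  · intro y hy
    obtain ⟨η, hη, rfl⟩ : ∃ η ∈ Ioo 0 Real.pi, Real.cos η = y :=
      ⟨Real.arccos y, ⟨Real.arccos_pos.2 hy.2, Real.arccos_lt_pi.2 hy.1⟩,
        Real.cos_arccos hy.1.le hy.2.le⟩
    rw [← integral_comp_cos_mul_sin]
    have h2 : ∫ θ in (0 : ℝ)..Real.pi, √(1 - Real.cos θ ^ 2) *
        (Chebyshev.U ℝ k).eval (Real.cos θ) * Real.log (Real.cos θ - Real.cos η) * Real.sin θ =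
        ∫ θ in (0 : ℝ)..Real.pi, 1 / 2 *
          (Real.log (Real.cos θ - Real.cos η) * Real.cos ((k : ℤ) * θ) -
            Real.log (Real.cos θ - Real.cos η) * Real.cos ((k + 2 : ℤ) * θ)) := by
      refine intervalIntegral.integral_congr fun θ hθ => ?_
      rw [uIcc_of_le Real.pi_pos.le] at hθ
      have h3 := Polynomial.Chebyshev.U_real_cos θ k
      have h4 : Real.cos ((k : ℤ) * θ) - Real.cos ((k + 2 : ℤ) * θ) =
          2 * (Real.sin (((k : ℤ) + 1) * θ) * Real.sin θ) := by
        rw [Real.cos_sub_cos]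
        have a1 : ((((k : ℤ) : ℝ) * θ + ((k + 2 : ℤ) : ℝ) * θ) / 2) = (((k : ℤ) : ℝ) + 1) * θ := by
          push_cast; ring
        have a2 : ((((k : ℤ) : ℝ) * θ - ((k + 2 : ℤ) : ℝ) * θ) / 2) = -θ := by
          push_cast; ring
        rw [a1, a2, Real.sin_neg]
        ring
      rw [← mul_sub, h4, ← h3, ← Real.sin_sq, Real.sqrt_sq (Real.sin_nonneg_of_mem_Icc hθ)]
      ring
    rw [h2, intervalIntegral.integral_const_mul, intervalIntegral.integral_sub
      (intervalIntegrable_log_cos_sub_mul_cos _ hη) (intervalIntegrable_log_cos_sub_mul_cos _ hη),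
      integral_log_cos_sub_mul_cos _ hη, integral_log_cos_sub_mul_cos _ hη]
    simp only [Polynomial.eval_add, Polynomial.eval_sub, Polynomial.eval_mul, Polynomial.eval_C,
      Polynomial.Chebyshev.T_real_cos, hc]
    ring

/-! ### The half-Laplacian of a test function as a logarithmic potential -/

/-- The half-Laplacian `(-Δ)^{1/2} φ` of a test function, as the logarithmic potential
`π⁻¹ ∫ φ''(y) log |x - y| dy`. -/
def halfLaplacian (φ : ℝ → ℝ) (x : ℝ) : ℝ :=
  Real.pi⁻¹ * ∫ y, deriv (deriv φ) y * Real.log (x - y)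

lemma integrableOn_mul_exp_neg {c : ℝ} (hc : 0 < c) :
    IntegrableOn (fun t : ℝ => t * Real.exp (-(c * t))) (Ioi 0) := by
  have := integrableOn_rpow_mul_exp_neg_mul_rpow (s := 1) (p := 1) (by norm_num) one_pos hc
  refine this.congr_fun (fun t _ => ?_) measurableSet_Ioi
  simp

lemma integrableOn_mul_cexp_neg {b : ℂ} (hb : 0 < b.re) :
    IntegrableOn (fun t : ℝ => (t : ℂ) * Complex.exp (-(b * t))) (Ioi 0) := by
  refine (integrableOn_mul_exp_neg hb).mono'
    (Continuous.aestronglyMeasurable (by fun_prop)) ?_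
  filter_upwards [ae_restrict_mem measurableSet_Ioi] with t ht
  rw [norm_mul, Complex.norm_real, Real.norm_of_nonneg (le_of_lt ht), Complex.norm_exp]
  simp

lemma integral_mul_cexp_neg {b : ℂ} (hb : 0 < b.re) :
    ∫ t in Ioi (0 : ℝ), (t : ℂ) * Complex.exp (-(b * t)) = 1 / b ^ 2 := by
  have hb0 : b ≠ 0 := fun h => by simp [h] at hb
  have hd : ∀ t : ℝ, HasDerivAt (fun t : ℝ => -((t : ℂ) / b + 1 / b ^ 2) * Complex.exp (-(b * t)))
      ((t : ℂ) * Complex.exp (-(b * t))) t := by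
    intro t
    have h1 : HasDerivAt (fun t : ℝ => (t : ℂ)) 1 t := by
      simpa using (hasDerivAt_id t).ofReal_comp
    have h2 := (((h1.div_const b).add_const (1 / b ^ 2)).neg).mul ((h1.const_mul b).neg.cexp)
    refine h2.congr_deriv ?_
    simp only [Pi.neg_apply]
    field_simp
    ring
  have hlim : Tendsto (fun t : ℝ => -((t : ℂ) / b + 1 / b ^ 2) * Complex.exp (-(b * t))) atTop
      (𝓝 0) := by
    have e0 : Tendsto (fun t : ℝ => Real.exp (-(b.re * t))) atTop (𝓝 0) :=
      Real.tendsto_exp_neg_atTop_nhds_zero.comp (tendsto_id.const_mul_atTop hb)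
    have e1 : Tendsto (fun t : ℝ => t * Real.exp (-(b.re * t))) atTop (𝓝 0) := by
      have := tendsto_rpow_mul_exp_neg_mul_atTop_nhds_zero 1 b.re hb
      simpa using this
    have e2 := (e1.mul_const (1 / ‖b‖)).add (e0.mul_const (1 / ‖b‖ ^ 2))
    simp only [zero_mul, add_zero] at e2
    refine squeeze_zero_norm' ?_ e2
    filter_upwards [eventually_ge_atTop (0 : ℝ)] with t ht
    rw [norm_mul, norm_neg, Complex.norm_exp]
    have h1 : ‖(t : ℂ) / b + 1 / b ^ 2‖ ≤ t / ‖b‖ + 1 / ‖b‖ ^ 2 := by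
      refine (norm_add_le _ _).trans_eq ?_
      simp [abs_of_nonneg ht]
    have h2 : (-(b * (t : ℂ))).re = -(b.re * t) := by simp
    rw [h2]
    have := mul_le_mul_of_nonneg_right h1 (Real.exp_pos (-(b.re * t))).le
    refine this.trans_eq ?_
    ring
  rw [integral_Ioi_of_hasDerivAt_of_tendsto (hd 0).continuousAt.continuousWithinAt
    (fun t _ => hd t) (integrableOn_mul_cexp_neg hb) hlim]
  simp

/-- The symbol `|k|`, `k = 2πξ`, damped by the factor `exp(-ε|k|)`. -/
def dampedSymbol (ε ξ : ℝ) : ℝ := 2 * Real.pi * |ξ| * Real.exp (-(2 * Real.pi * ε * |ξ|))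

lemma dampedSymbol_neg (ε ξ : ℝ) : dampedSymbol ε (-ξ) = dampedSymbol ε ξ := by
  simp [dampedSymbol]

lemma continuous_dampedSymbol (ε : ℝ) : Continuous (dampedSymbol ε) := by
  unfold dampedSymbol
  fun_prop

lemma integrable_dampedSymbol {ε : ℝ} (hε : 0 < ε) : Integrable (dampedSymbol ε) := by
  have h : IntegrableOn (fun t => 2 * Real.pi * (t * Real.exp (-(2 * Real.pi * ε * t)))) (Ioi 0) :=
    (integrableOn_mul_exp_neg (c := 2 * Real.pi * ε) (by positivity)).const_mul (2 * Real.pi)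
  have h1 : IntegrableOn (dampedSymbol ε) (Ioi 0) := by
    refine h.congr_fun (fun t ht => ?_) measurableSet_Ioi
    simp only [dampedSymbol, abs_of_pos (show 0 < t from ht)]
    ring
  have h2 : IntegrableOn (dampedSymbol ε) (Iic 0) := by
    rw [integrableOn_Iic_iff_integrableOn_Iio]
    have h3 : IntegrableOn (dampedSymbol ε) (Ioi (-0)) := by rwa [neg_zero]
    exact h3.comp_neg_Iio.congr_fun (fun t _ => dampedSymbol_neg ε t) measurableSet_Iio
  rw [← integrableOn_univ, ← Iic_union_Ioi (a := (0 : ℝ))]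
  exact h2.union h1

/-- The Fourier transform of the damped symbol is the real part of `π⁻¹ (ε + is)⁻²`. -/
lemma fourier_dampedSymbol {ε : ℝ} (hε : 0 < ε) (s : ℝ) :
    𝓕 (fun ξ => (dampedSymbol ε ξ : ℂ)) s =
      ((Real.pi⁻¹ * ((ε ^ 2 - s ^ 2) / (s ^ 2 + ε ^ 2) ^ 2) : ℝ) : ℂ) := by
  have hπ := Real.pi_pos
  set F : ℝ → ℂ := fun ξ => Complex.exp (↑(-2 * Real.pi * ξ * s) * Complex.I) •
    (dampedSymbol ε ξ : ℂ) with hF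
  have hFi : Integrable F := by
    refine (integrable_dampedSymbol hε).ofReal (𝕜 := ℂ) |>.mono
      (Continuous.aestronglyMeasurable ?_) (Eventually.of_forall fun ξ => ?_)
    · have := continuous_dampedSymbol ε
      simp only [hF]
      fun_prop
    · rw [norm_smul, Complex.norm_exp_ofReal_mul_I, one_mul]
      rfl
  have e1 : ∫ ξ in Ioi (0 : ℝ), F ξ =
      2 * Real.pi * (1 / (2 * Real.pi * (ε + s * Complex.I)) ^ 2) := by
    have hb : 0 < (2 * (Real.pi : ℂ) * (ε + s * Complex.I)).re := by
      have : (2 * (Real.pi : ℂ) * (ε + s * Complex.I)).re = 2 * Real.pi * ε := by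
        simp
      rw [this]; positivity
    rw [← integral_mul_cexp_neg hb, ← integral_const_mul]
    refine setIntegral_congr_fun measurableSet_Ioi fun ξ hξ => ?_
    simp only [hF, dampedSymbol, abs_of_pos (show 0 < ξ from hξ), smul_eq_mul]
    push_cast
    rw [show -(2 * (Real.pi : ℂ) * (ε + s * Complex.I) * ξ) =
      -2 * Real.pi * ξ * s * Complex.I + -(2 * Real.pi * ε * ξ) by ring, Complex.exp_add]
    ring
  have e2 : ∫ ξ in Iic (0 : ℝ), F ξ =
      2 * Real.pi * (1 / (2 * Real.pi * (ε - s * Complex.I)) ^ 2) := by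
    have hb : 0 < (2 * (Real.pi : ℂ) * (ε - s * Complex.I)).re := by
      have : (2 * (Real.pi : ℂ) * (ε - s * Complex.I)).re = 2 * Real.pi * ε := by
        simp
      rw [this]; positivity
    rw [← integral_mul_cexp_neg hb, ← integral_const_mul, ← neg_zero, ← integral_comp_neg_Ioi,
      neg_zero]
    refine setIntegral_congr_fun measurableSet_Ioi fun ξ hξ => ?_
    simp only [hF, dampedSymbol, abs_neg, abs_of_pos (show 0 < ξ from hξ), smul_eq_mul]
    push_cast
    rw [show -(2 * (Real.pi : ℂ) * (ε - s * Complex.I) * ξ) =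
      -2 * Real.pi * -ξ * s * Complex.I + -(2 * Real.pi * ε * ξ) by ring, Complex.exp_add]
    ring
  rw [Real.fourier_eq']
  have e3 : ∫ v : ℝ, Complex.exp (↑(-2 * Real.pi * inner ℝ v s) * Complex.I) •
      (dampedSymbol ε v : ℂ) = ∫ ξ, F ξ := by
    refine integral_congr_ae (Eventually.of_forall fun ξ => ?_)
    simp only [hF]
    congr 4
    simp only [RCLike.inner_apply, conj_trivial]
    ring
  rw [e3, ← intervalIntegral.integral_Iic_add_Ioi hFi.integrableOn hFi.integrableOn, e1, e2]
  have hsum : ((s : ℂ) ^ 2 + ε ^ 2) ≠ 0 := by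
    have : (0 : ℝ) < s ^ 2 + ε ^ 2 := by positivity
    exact_mod_cast this.ne'
  have hprod : ((ε : ℂ) + s * Complex.I) * (ε - s * Complex.I) = s ^ 2 + ε ^ 2 := by
    linear_combination (-(s : ℂ) ^ 2) * Complex.I_sq
  have hp : (ε : ℂ) + s * Complex.I ≠ 0 := fun h => hsum (by rw [← hprod, h, zero_mul])
  have hm : (ε : ℂ) - s * Complex.I ≠ 0 := fun h => hsum (by rw [← hprod, h, mul_zero])
  have hπ' : (Real.pi : ℂ) ≠ 0 := by exact_mod_cast hπ.ne'
  push_cast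
  rw [← hprod]
  field_simp
  linear_combination (2 * (s : ℂ) ^ 2) * Complex.I_sq

lemma hasDerivAt_log_sq_add {ε : ℝ} (hε : 0 < ε) (x y : ℝ) :
    HasDerivAt (fun y => Real.log ((y - x) ^ 2 + ε ^ 2))
      (2 * (y - x) / ((y - x) ^ 2 + ε ^ 2)) y := by
  have h1 : HasDerivAt (fun y => (y - x) ^ 2 + ε ^ 2) (2 * (y - x)) y := by
    simpa using (((hasDerivAt_id y).sub_const x).fun_pow 2).add_const (ε ^ 2)
  exact h1.log (by positivity)

lemma hasDerivAt_two_mul_div {ε : ℝ} (hε : 0 < ε) (x y : ℝ) :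
    HasDerivAt (fun y => 2 * (y - x) / ((y - x) ^ 2 + ε ^ 2))
      (2 * ((ε ^ 2 - (y - x) ^ 2) / ((y - x) ^ 2 + ε ^ 2) ^ 2)) y := by
  have h1 : HasDerivAt (fun y => (y - x) ^ 2 + ε ^ 2) (2 * (y - x)) y := by
    simpa using (((hasDerivAt_id y).sub_const x).fun_pow 2).add_const (ε ^ 2)
  have h2 : HasDerivAt (fun y => 2 * (y - x)) 2 y := by
    simpa using ((hasDerivAt_id y).sub_const x).const_mul 2
  have h0 : (y - x) ^ 2 + ε ^ 2 ≠ 0 := by positivity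
  refine (h2.div h1 h0).congr_deriv ?_
  field_simp
  ring

/-- Integration by parts against a compactly supported `C¹` function. -/
lemma integral_mul_deriv_of_hasCompactSupport {φ u u' : ℝ → ℝ} (hφ : ContDiff ℝ 1 φ)
    (hc : HasCompactSupport φ) (hu : ∀ y, HasDerivAt u (u' y) y) (hu' : Continuous u') :
    ∫ y, φ y * u' y = -∫ y, deriv φ y * u y := by
  have huc : Continuous u := continuous_iff_continuousAt.2 fun y => (hu y).continuousAt
  have hφ' : Continuous (deriv φ) := hφ.continuous_deriv le_rfl
  refine integral_mul_deriv_eq_deriv_mul_of_integrable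
    (fun y _ => (hφ.differentiable (by norm_num) y).hasDerivAt) (fun y _ => hu y) ?_ ?_ ?_
  · exact (hφ.continuous.mul hu').integrable_of_hasCompactSupport hc.mul_right
  · exact (hφ'.mul huc).integrable_of_hasCompactSupport hc.deriv.mul_right
  · exact (hφ.continuous.mul huc).integrable_of_hasCompactSupport hc.mul_right

lemma contDiff_one_deriv {φ : ℝ → ℝ} (hφ : ContDiff ℝ 2 φ) : ContDiff ℝ 1 (deriv φ) :=
  ((contDiff_succ_iff_deriv (n := 1)).1 (by simpa [one_add_one_eq_two] using hφ)).2.2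

lemma continuous_deriv_deriv {φ : ℝ → ℝ} (hφ : ContDiff ℝ 2 φ) : Continuous (deriv (deriv φ)) :=
  (contDiff_one_deriv hφ).continuous_deriv le_rfl

lemma integral_mul_kernel {φ : ℝ → ℝ} (hφ : ContDiff ℝ 2 φ) (hc : HasCompactSupport φ) {ε : ℝ}
    (hε : 0 < ε) (x : ℝ) :
    ∫ y, φ y * (Real.pi⁻¹ * ((ε ^ 2 - (y - x) ^ 2) / ((y - x) ^ 2 + ε ^ 2) ^ 2)) =
      Real.pi⁻¹ * ∫ y, deriv (deriv φ) y * (1 / 2 * Real.log ((y - x) ^ 2 + ε ^ 2)) := by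
  have hd1 := contDiff_one_deriv hφ
  have h0 : ∀ y : ℝ, (y - x) ^ 2 + ε ^ 2 ≠ 0 := fun y => by positivity
  have e1 := integral_mul_deriv_of_hasCompactSupport (hφ.of_le (by norm_num)) hc
    (hasDerivAt_two_mul_div hε x)
    (continuous_const.mul (Continuous.div (by fun_prop) (by fun_prop)
      fun y => pow_ne_zero 2 (h0 y)))
  have e2 := integral_mul_deriv_of_hasCompactSupport hd1 hc.deriv (hasDerivAt_log_sq_add hε x)
    (Continuous.div (by fun_prop) (by fun_prop) h0)
  rw [e2, neg_neg] at e1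
  have e3 : ∀ y, φ y * (Real.pi⁻¹ * ((ε ^ 2 - (y - x) ^ 2) / ((y - x) ^ 2 + ε ^ 2) ^ 2)) =
      (Real.pi⁻¹ * (1 / 2)) *
        (φ y * (2 * ((ε ^ 2 - (y - x) ^ 2) / ((y - x) ^ 2 + ε ^ 2) ^ 2))) := by
    intro y; ring
  have e4 : ∀ y, deriv (deriv φ) y * (1 / 2 * Real.log ((y - x) ^ 2 + ε ^ 2)) =
      1 / 2 * (deriv (deriv φ) y * Real.log ((y - x) ^ 2 + ε ^ 2)) := by
    intro y; ring
  simp_rw [e3, e4]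
  rw [integral_const_mul, integral_const_mul, e1, mul_assoc]

lemma abs_log_sq_add_le {ε s : ℝ} (hε : 0 < ε) (hε1 : ε < 1) (hs : s ≠ 0) :
    |Real.log (s ^ 2 + ε ^ 2)| ≤ 2 * |Real.log s| + Real.log (s ^ 2 + 1) := by
  have hs2 : 0 < s ^ 2 := by positivity
  have h1 : Real.log (s ^ 2) = 2 * Real.log s := by rw [Real.log_pow]; norm_num
  have h2 : Real.log (s ^ 2) ≤ Real.log (s ^ 2 + ε ^ 2) :=
    Real.log_le_log hs2 (by nlinarith)
  have h3 : Real.log (s ^ 2 + ε ^ 2) ≤ Real.log (s ^ 2 + 1) :=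
    Real.log_le_log (by positivity) (by nlinarith)
  have h4 : 0 ≤ Real.log (s ^ 2 + 1) := Real.log_nonneg (by linarith)
  have h5 := abs_nonneg (Real.log s)
  have h6 := neg_abs_le (Real.log s)
  rw [abs_le]
  constructor <;> linarith

lemma locallyIntegrable_abs_log_sub (x : ℝ) :
    LocallyIntegrable (fun y : ℝ => |Real.log (y - x)|) := by
  refine locallyIntegrable_iff.2 fun K hK => ?_
  obtain ⟨r, hr⟩ := hK.isBounded.subset_closedBall 0
  rw [Real.closedBall_eq_Icc] at hr
  have h := (intervalIntegrable_log_sub x (0 - |r|) (0 + |r|)).abs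
  rw [intervalIntegrable_iff_integrableOn_Icc_of_le (by linarith [abs_nonneg r])] at h
  exact h.mono_set (hr.trans (Icc_subset_Icc (by linarith [le_abs_self r])
    (by linarith [le_abs_self r])))

lemma tendsto_integral_mul_log {g : ℝ → ℝ} (hg : Continuous g) (hc : HasCompactSupport g) (x : ℝ) :
    Tendsto (fun ε : ℝ => ∫ y, g y * (1 / 2 * Real.log ((y - x) ^ 2 + ε ^ 2))) (𝓝[>] 0)
      (𝓝 (∫ y, g y * Real.log (y - x))) := by
  have hne : ∀ᵐ y : ℝ, y ≠ x := by simp [ae_iff, measure_singleton]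
  have hbound : Integrable
      (fun y => ‖g y‖ * (2 * |Real.log (y - x)| + Real.log ((y - x) ^ 2 + 1))) := by
    have h1 : LocallyIntegrable
        (fun y => 2 * |Real.log (y - x)| + Real.log ((y - x) ^ 2 + 1)) := by
      refine LocallyIntegrable.add ?_ ?_
      · exact (locallyIntegrable_abs_log_sub x).smul (2 : ℝ)
      · refine Continuous.locallyIntegrable (Continuous.log (by fun_prop) fun y => ?_)
        positivity
    have := h1.integrable_smul_left_of_hasCompactSupport hg.norm hc.norm
    simpa [smul_eq_mul] using this
  refine tendsto_integral_filter_of_dominated_convergence _ (Eventually.of_forall fun ε => ?_) ?_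
    hbound ?_
  · exact Measurable.aestronglyMeasurable (by have := hg.measurable; fun_prop)
  · filter_upwards [Ioo_mem_nhdsGT (show (0 : ℝ) < 1 by norm_num)] with ε hε
    filter_upwards [hne] with y hy
    have h1 := abs_log_sq_add_le hε.1 hε.2 (sub_ne_zero.2 hy)
    rw [norm_mul, norm_mul, Real.norm_eq_abs (Real.log _)]
    refine mul_le_mul_of_nonneg_left ?_ (norm_nonneg _)
    have h2 : ‖(1 / 2 : ℝ)‖ = 1 / 2 := by norm_num
    rw [h2]
    have := abs_nonneg (Real.log ((y - x) ^ 2 + ε ^ 2))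
    linarith
  · filter_upwards [hne] with y hy
    have hy0 : y - x ≠ 0 := sub_ne_zero.2 hy
    have h1 : Tendsto (fun ε : ℝ => (y - x) ^ 2 + ε ^ 2) (𝓝[>] 0) (𝓝 ((y - x) ^ 2)) := by
      have : Continuous (fun ε : ℝ => (y - x) ^ 2 + ε ^ 2) := by fun_prop
      simpa using (this.tendsto 0).mono_left nhdsWithin_le_nhds
    have h2 := (((Real.continuousAt_log (pow_ne_zero 2 hy0)).tendsto.comp h1).const_mul
      (1 / 2)).const_mul (g y)
    have h3 : 1 / 2 * Real.log ((y - x) ^ 2) = Real.log (y - x) := by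
      rw [Real.log_pow]; push_cast; ring
    rw [h3] at h2
    exact h2

lemma integrable_abs_mul_schwartz (g : 𝓢(ℝ, ℂ)) :
    Integrable (fun ξ : ℝ => ((2 * Real.pi * |ξ| : ℝ) : ℂ) * g ξ) := by
  refine ((g.integrable_pow_mul volume 1).const_mul (2 * Real.pi)).mono'
    (Continuous.aestronglyMeasurable (by have := g.continuous; fun_prop))
    (Eventually.of_forall fun ξ => ?_)
  rw [norm_mul, Complex.norm_real, Real.norm_of_nonneg (by positivity), pow_one, Real.norm_eq_abs,
    mul_assoc]

/-- The Fourier multiplier `|k|` acts on test functions as `halfLaplacian`. -/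
lemma fourier_abs_mul_fourierInv {φ : ℝ → ℝ} (hφ : ContDiff ℝ 2 φ) (hc : HasCompactSupport φ)
    (Φ : 𝓢(ℝ, ℂ)) (hΦ : ∀ x, Φ x = φ x) (x : ℝ) :
    𝓕 (fun ξ : ℝ => ((2 * Real.pi * |ξ| : ℝ) : ℂ) * (𝓕⁻ Φ) ξ) x = (halfLaplacian φ x : ℂ) := by
  set g : 𝓢(ℝ, ℂ) := 𝓕⁻ Φ with hg
  -- the damped multiplier is a convolution with an explicit kernel
  have key : ∀ ε > 0, 𝓕 (fun ξ : ℝ => (dampedSymbol ε ξ : ℂ) * g ξ) x =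
      ((Real.pi⁻¹ * ∫ y, deriv (deriv φ) y * (1 / 2 * Real.log ((y - x) ^ 2 + ε ^ 2)) : ℝ) :
        ℂ) := by
    intro ε hε
    set m : ℝ → ℂ := fun ξ => Complex.exp (↑(2 * Real.pi * ξ * x) * Complex.I) * dampedSymbol ε ξ
      with hm
    have hmi : Integrable m := by
      refine (integrable_dampedSymbol hε).ofReal (𝕜 := ℂ) |>.mono
        (Continuous.aestronglyMeasurable ?_) (Eventually.of_forall fun ξ => ?_)
      · have := continuous_dampedSymbol ε
        simp only [hm]
        fun_prop
      · rw [hm, norm_mul, Complex.norm_exp_ofReal_mul_I, one_mul]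
        rfl
    have s1 : 𝓕 (fun ξ : ℝ => (dampedSymbol ε ξ : ℂ) * g ξ) x = ∫ ξ, 𝓕 (Φ : ℝ → ℂ) ξ • m ξ := by
      rw [Real.fourier_eq', ← integral_neg_eq_self]
      refine integral_congr_ae (Eventually.of_forall fun ξ => ?_)
      simp only [hm, hg, dampedSymbol_neg, smul_eq_mul, SchwartzMap.fourierInv_coe,
        Real.fourierInv_eq_fourier_neg, neg_neg, RCLike.inner_apply, conj_trivial]
      have : -2 * Real.pi * (x * -ξ) = 2 * Real.pi * ξ * x := by ring
      rw [this]
      ring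
    have s2 : ∫ ξ, 𝓕 (Φ : ℝ → ℂ) ξ • m ξ = ∫ y, Φ y • 𝓕 m y := by
      simpa using! VectorFourier.integral_fourierIntegral_smul_eq_flip (L := innerₗ ℝ)
        Real.continuous_fourierChar continuous_inner Φ.integrable hmi
    have s3 : ∀ y, 𝓕 m y = 𝓕 (fun ξ => (dampedSymbol ε ξ : ℂ)) (y - x) := by
      intro y
      rw [Real.fourier_eq', Real.fourier_eq']
      refine integral_congr_ae (Eventually.of_forall fun ξ => ?_)
      simp only [hm, smul_eq_mul, RCLike.inner_apply, conj_trivial]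
      rw [← mul_assoc, ← Complex.exp_add]
      congr 2
      push_cast
      ring
    rw [s1, s2, ← integral_mul_kernel hφ hc hε, ← integral_complex_ofReal]
    refine integral_congr_ae (Eventually.of_forall fun y => ?_)
    simp only [s3, fourier_dampedSymbol hε, hΦ, smul_eq_mul]
    push_cast
    ring
  have lim1 : Tendsto (fun ε : ℝ => 𝓕 (fun ξ : ℝ => (dampedSymbol ε ξ : ℂ) * g ξ) x) (𝓝[>] 0)
      (𝓝 (𝓕 (fun ξ : ℝ => ((2 * Real.pi * |ξ| : ℝ) : ℂ) * g ξ) x)) := by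
    simp only [Real.fourier_eq']
    refine tendsto_integral_filter_of_dominated_convergence _ (Eventually.of_forall fun ε => ?_) ?_
      (integrable_abs_mul_schwartz g).norm ?_
    · have := continuous_dampedSymbol ε
      have := g.continuous
      exact Continuous.aestronglyMeasurable (by fun_prop)
    · filter_upwards [self_mem_nhdsWithin] with ε hε
      refine Eventually.of_forall fun ξ => ?_
      rw [norm_smul, Complex.norm_exp_ofReal_mul_I, one_mul, norm_mul, norm_mul, Complex.norm_real,
        Complex.norm_real]
      refine mul_le_mul_of_nonneg_right ?_ (norm_nonneg _)
      rw [dampedSymbol, norm_mul, Real.norm_of_nonneg (Real.exp_pos _).le]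
      refine mul_le_of_le_one_right (norm_nonneg _) (Real.exp_le_one_iff.2 ?_)
      have : 0 < ε := hε
      rw [neg_nonpos]
      positivity
    · refine Eventually.of_forall fun ξ => ?_
      have : Continuous (fun ε : ℝ => Complex.exp (↑(-2 * Real.pi * inner ℝ ξ x) * Complex.I) •
          ((dampedSymbol ε ξ : ℂ) * g ξ)) := by
        unfold dampedSymbol
        fun_prop
      have h := (this.tendsto 0).mono_left (nhdsWithin_le_nhds (s := Ioi 0))
      simpa [dampedSymbol] using h
  have hd2 := continuous_deriv_deriv hφ
  have lim2 := (Complex.continuous_ofReal.tendsto _).comp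
    ((tendsto_integral_mul_log hd2 hc.deriv.deriv x).const_mul Real.pi⁻¹)
  have hl : (halfLaplacian φ x : ℂ) =
      ((Real.pi⁻¹ * ∫ y, deriv (deriv φ) y * Real.log (y - x) : ℝ) : ℂ) := by
    rw [halfLaplacian]
    congr 3 with y
    rw [← Real.log_neg_eq_log, neg_sub]
  rw [hl]
  refine tendsto_nhds_unique_of_eventuallyEq lim1 lim2 ?_
  filter_upwards [self_mem_nhdsWithin] with ε hε using key ε hε

lemma halfLaplacian_continuous_bounded {φ : ℝ → ℝ} (hφ : ContDiff ℝ 2 φ) (hc : HasCompactSupport φ)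
    (Φ : 𝓢(ℝ, ℂ)) (hΦ : ∀ x, Φ x = φ x) :
    Continuous (halfLaplacian φ) ∧ ∃ M, ∀ x, |halfLaplacian φ x| ≤ M := by
  have hi := integrable_abs_mul_schwartz (𝓕⁻ Φ)
  have he := fourier_abs_mul_fourierInv hφ hc Φ hΦ
  have hcont : Continuous (𝓕 (fun ξ : ℝ => ((2 * Real.pi * |ξ| : ℝ) : ℂ) * (𝓕⁻ Φ) ξ)) :=
    VectorFourier.fourierIntegral_continuous Real.continuous_fourierChar (by fun_prop) hi
  refine ⟨?_, ∫ ξ : ℝ, ‖((2 * Real.pi * |ξ| : ℝ) : ℂ) * (𝓕⁻ Φ) ξ‖, fun x => ?_⟩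
  · rw [funext he] at hcont
    exact (Complex.continuous_re.comp hcont).congr fun x => Complex.ofReal_re _
  · rw [← Real.norm_eq_abs, ← Complex.norm_real, ← he]
    exact VectorFourier.norm_fourierIntegral_le_integral_norm _ _ _ _ _

/-! ### The Green function inverts the half-Laplacian -/

lemma exists_bound_eval (p : Polynomial ℝ) : ∃ M, ∀ x ∈ Icc (-1 : ℝ) 1, ‖p.eval x‖ ≤ M :=
  isCompact_Icc.exists_bound_of_continuousOn p.continuous.continuousOn

/-- Symmetry of the Green function and the explicit potential of `U_k`. -/
lemma integral_greenPotential_mul_U {ψ : ℝ → ℝ} (hψ : Continuous ψ) (k : ℕ) :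
    ((k : ℝ) + 1) * ∫ z in (-1 : ℝ)..1, greenPotential ψ z * (Chebyshev.U ℝ k).eval z =
      ∫ x in (-1 : ℝ)..1, √(1 - x ^ 2) * (Chebyshev.U ℝ k).eval x * ψ x := by
  obtain ⟨M, hM⟩ := exists_bound_eval (Chebyshev.U ℝ k)
  have hs := IsSource.of_continuous hψ
  have hi : Integrable (Function.uncurry fun z x : ℝ =>
      greenG z x * ψ x * (Chebyshev.U ℝ k).eval z) (volume.prod volume) := by
    refine (hs.integrable_prod.norm.mul_const M).mono' ?_ (Eventually.of_forall fun p => ?_)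
    · have := measurable_greenG
      exact (Measurable.aestronglyMeasurable (by
        have := hψ.measurable
        simp only [Function.uncurry_def]
        fun_prop))
    · simp only [Function.uncurry_def]
      rw [norm_mul]
      by_cases hp : p.1 ∈ Ioo (-1 : ℝ) 1
      · exact mul_le_mul_of_nonneg_left (hM _ (Ioo_subset_Icc_self hp)) (norm_nonneg _)
      · simp [greenG_eq_zero_of_left hp]
  have e1 : ∫ z in (-1 : ℝ)..1, greenPotential ψ z * (Chebyshev.U ℝ k).eval z =
      ∫ z, ∫ x, greenG z x * ψ x * (Chebyshev.U ℝ k).eval z := by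
    rw [intervalIntegral.integral_of_le (by norm_num),
      setIntegral_eq_integral_of_forall_compl_eq_zero fun z hz => by
        rw [greenPotential_eq_zero ψ fun h => hz (Ioo_subset_Ioc_self h), zero_mul]]
    refine integral_congr_ae (Eventually.of_forall fun z => ?_)
    simp only
    rw [integral_mul_const, greenPotential]
  have e2 : ∀ x, ((k : ℝ) + 1) * ∫ z, greenG z x * ψ x * (Chebyshev.U ℝ k).eval z =
      √(1 - x ^ 2) * (Chebyshev.U ℝ k).eval x * ψ x := by
    intro x
    by_cases hx : x ∈ Ioo (-1 : ℝ) 1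
    · rw [← integral_greenG_mul_U k hx, mul_assoc, ← integral_mul_const]
      congr 2 with z
      rw [greenG_comm]
      ring
    · simp [greenG_eq_zero_of_right hx, Real.sqrt_eq_zero_of_nonpos (one_sub_sq_nonpos hx)]
  rw [e1, integral_integral_swap hi, ← integral_const_mul]
  simp_rw [e2]
  rw [intervalIntegral.integral_of_le (by norm_num)]
  refine (setIntegral_eq_integral_of_forall_compl_eq_zero fun x hx => ?_).symm
  rw [Real.sqrt_eq_zero_of_nonpos (one_sub_sq_nonpos fun h => hx (Ioo_subset_Ioc_self h))]
  simp

lemma deriv_deriv_eq_zero_of_notMem_tsupport {φ : ℝ → ℝ} {y : ℝ} (hy : y ∉ tsupport φ) :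
    deriv (deriv φ) y = 0 := by
  by_contra h
  exact hy (tsupport_deriv_subset (tsupport_deriv_subset (subset_tsupport _ h)))

lemma integrable_log_sub_prod {g : ℝ → ℝ} (hg : Integrable g) :
    Integrable (fun p : ℝ × ℝ => g p.2 * (Ioc (-2 : ℝ) 2).indicator Real.log (p.1 - p.2))
      (volume.prod volume) := by
  have h : IntervalIntegrable Real.log volume (-2) 2 := by
    simp
  have h2 : Integrable ((Ioc (-2 : ℝ) 2).indicator Real.log) :=
    (integrable_indicator_iff measurableSet_Ioc).2
      ((intervalIntegrable_iff_integrableOn_Ioc_of_le (by norm_num)).1 h)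
  exact hg.convolution_integrand (ContinuousLinearMap.mul ℝ ℝ) h2

/-- Symmetry of the half-Laplacian, tested on `√(1-x²) U_k(x)`: the logarithmic potential of this
function is a polynomial whose second derivative is `π (k+1) U_k`. -/
lemma integral_sqrt_mul_U_mul_halfLaplacian {φ : ℝ → ℝ} (hφ : ContDiff ℝ 2 φ)
    (hc : HasCompactSupport φ) (hsub : tsupport φ ⊆ Ioo (-1) 1) (k : ℕ) :
    ∫ x in (-1 : ℝ)..1, √(1 - x ^ 2) * (Chebyshev.U ℝ k).eval x * halfLaplacian φ x =
      ((k : ℝ) + 1) * ∫ y, φ y * (Chebyshev.U ℝ k).eval y := by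
  obtain ⟨M, hM⟩ := exists_bound_eval (Chebyshev.U ℝ k)
  obtain ⟨W, hW, hWint⟩ := exists_polynomial_integral_log k
  have hd2 := continuous_deriv_deriv hφ
  have hd2i : Integrable (deriv (deriv φ)) := hd2.integrable_of_hasCompactSupport hc.deriv.deriv
  set w : ℝ → ℝ := fun x => √(1 - x ^ 2) * (Chebyshev.U ℝ k).eval x with hw
  have hwc : Continuous w := by simp only [hw]; fun_prop
  have hi : Integrable (Function.uncurry fun x y : ℝ =>
      w x * (deriv (deriv φ) y * Real.log (x - y)))
      ((volume.restrict (Ioc (-1 : ℝ) 1)).prod volume) := by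
    have h1 : Integrable (fun p : ℝ × ℝ => deriv (deriv φ) p.2 *
        (Ioc (-2 : ℝ) 2).indicator Real.log (p.1 - p.2))
        ((volume.restrict (Ioc (-1 : ℝ) 1)).prod volume) := by
      have : (volume.restrict (Ioc (-1 : ℝ) 1)).prod (volume : Measure ℝ) =
          (volume.prod volume).restrict (Ioc (-1 : ℝ) 1 ×ˢ univ) := by
        rw [← Measure.prod_restrict, Measure.restrict_univ]
      rw [this]
      exact (integrable_log_sub_prod hd2i).integrableOn
    have hmem : ∀ᵐ p : ℝ × ℝ ∂((volume.restrict (Ioc (-1 : ℝ) 1)).prod volume),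
        p.1 ∈ Ioc (-1 : ℝ) 1 :=
      Measure.quasiMeasurePreserving_fst.ae (ae_restrict_mem measurableSet_Ioc)
    refine (h1.bdd_mul (f := fun p : ℝ × ℝ => w p.1) (c := M)
      (hwc.comp continuous_fst).aestronglyMeasurable ?_).congr ?_
    · filter_upwards [hmem] with p hp
      have hp' := Ioc_subset_Icc_self hp
      rw [hw, norm_mul, Real.norm_of_nonneg (Real.sqrt_nonneg _)]
      have h2 : √(1 - p.1 ^ 2) ≤ 1 := Real.sqrt_le_one.2 (by nlinarith [sq_nonneg p.1])
      exact (mul_le_of_le_one_left (norm_nonneg _) h2).trans (hM _ hp')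
    · filter_upwards [hmem] with p hp
      simp only [Function.uncurry_def]
      by_cases hy : p.2 ∈ tsupport φ
      · have hy1 := hsub hy
        rw [indicator_of_mem (show p.1 - p.2 ∈ Ioc (-2 : ℝ) 2 from
          ⟨by linarith [hp.1, hy1.2], by linarith [hp.2, hy1.1]⟩)]
      · simp [deriv_deriv_eq_zero_of_notMem_tsupport hy]
  have e1 : ∫ x in (-1 : ℝ)..1, w x * halfLaplacian φ x =
      Real.pi⁻¹ * ∫ x in Ioc (-1 : ℝ) 1, ∫ y, w x * (deriv (deriv φ) y * Real.log (x - y)) := by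
    rw [intervalIntegral.integral_of_le (by norm_num), ← integral_const_mul]
    refine integral_congr_ae (Eventually.of_forall fun x => ?_)
    simp only [halfLaplacian]
    rw [integral_const_mul]
    ring
  have e2 : ∀ y, ∫ x in Ioc (-1 : ℝ) 1, w x * (deriv (deriv φ) y * Real.log (x - y)) =
      deriv (deriv φ) y * W.eval y := by
    intro y
    by_cases hy : y ∈ tsupport φ
    · rw [← hWint y (hsub hy), intervalIntegral.integral_of_le (by norm_num), ← integral_const_mul]
      congr 1 with x
      simp only [hw]
      ring
    · simp [deriv_deriv_eq_zero_of_notMem_tsupport hy]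
  have hd1 := contDiff_one_deriv hφ
  have p1 := integral_mul_deriv_of_hasCompactSupport hd1 hc.deriv (fun y => W.hasDerivAt y)
    (Polynomial.continuous _)
  have p2 := integral_mul_deriv_of_hasCompactSupport (hφ.of_le (by norm_num)) hc
    (fun y => (Polynomial.derivative W).hasDerivAt y) (Polynomial.continuous _)
  rw [p1, neg_neg] at p2
  rw [e1, integral_integral_swap hi]
  simp_rw [e2]
  rw [← p2, hW]
  have hder : Polynomial.derivative (Polynomial.C Real.pi * Chebyshev.T ℝ (k + 1)) =
      Polynomial.C (Real.pi * (k + 1)) * Chebyshev.U ℝ k := by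
    rw [Polynomial.derivative_mul, Polynomial.derivative_C, zero_mul, zero_add,
      Polynomial.Chebyshev.T_derivative_eq_U, add_sub_cancel_right, Polynomial.C_mul]
    simp only [Polynomial.C_add, map_natCast, map_one]
    push_cast
    ring
  rw [hder]
  simp only [Polynomial.eval_mul, Polynomial.eval_C]
  rw [← integral_const_mul, ← integral_const_mul]
  refine integral_congr_ae (Eventually.of_forall fun y => ?_)
  have := Real.pi_pos
  simp only
  field_simp

/-- A continuous function that vanishes off `[-1,1]` and is orthogonal to the Chebyshev
polynomials `U_k` is zero: the `U_k` span the polynomials, which are dense. -/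
lemma eq_zero_of_forall_integral_mul_U {D : ℝ → ℝ} (hD : Continuous D)
    (h0 : ∀ x ∉ Icc (-1 : ℝ) 1, D x = 0)
    (hU : ∀ k : ℕ, ∫ x, D x * (Chebyshev.U ℝ k).eval x = 0) : D = 0 := by
  have hc : HasCompactSupport D := HasCompactSupport.intro isCompact_Icc h0
  have hint : ∀ p : Polynomial ℝ, Integrable (fun x => D x * p.eval x) := fun p =>
    (hD.mul p.continuous).integrable_of_hasCompactSupport hc.mul_right
  have hXU : ∀ j k : ℕ, ∫ x, D x * (Polynomial.X ^ j * Chebyshev.U ℝ k).eval x = 0 := by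
    intro j
    induction j with
    | zero => simpa using hU
    | succ j ih =>
      -- for `k = 0` this is `U_{-1} = 0`, which starts the recurrence below
      have ih' : ∀ k : ℕ,
          ∫ x, D x * (Polynomial.X ^ j * Chebyshev.U ℝ ((k : ℤ) - 1)).eval x = 0 := by
        intro k
        cases k with
        | zero => simp
        | succ k => simpa using ih k
      intro k
      have hrec : ∀ x, D x * (Polynomial.X ^ (j + 1) * Chebyshev.U ℝ k).eval x =
          1 / 2 * (D x * (Polynomial.X ^ j * Chebyshev.U ℝ (k + 1 : ℕ)).eval x +
            D x * (Polynomial.X ^ j * Chebyshev.U ℝ ((k : ℤ) - 1)).eval x) := by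
        intro x
        have h := congrArg (Polynomial.eval x) (Polynomial.Chebyshev.U_add_one ℝ (k : ℤ))
        push_cast
        simp only [Polynomial.eval_mul, Polynomial.eval_sub, Polynomial.eval_pow,
          Polynomial.eval_X, Polynomial.eval_ofNat] at h ⊢
        rw [h]
        ring
      simp_rw [hrec]
      rw [integral_const_mul, integral_add (hint _) (hint _), ih, ih' k]
      simp
  have hp : ∀ p : Polynomial ℝ, ∫ x, D x * p.eval x = 0 := by
    intro p
    induction p using Polynomial.induction_on' with
    | add p q hp hq =>
      simp only [Polynomial.eval_add, mul_add]
      rw [integral_add (hint p) (hint q), hp, hq, add_zero]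
    | monomial n a =>
      have := hXU n 0
      simp only [Nat.cast_zero, Polynomial.Chebyshev.U_zero, mul_one, Polynomial.eval_pow,
        Polynomial.eval_X] at this
      simp only [Polynomial.eval_monomial]
      have e : ∀ x, D x * (a * x ^ n) = a * (D x * x ^ n) := fun x => by ring
      simp_rw [e]
      rw [integral_const_mul, this, mul_zero]
  have hDi : Integrable D := hD.integrable_of_hasCompactSupport hc
  have hsq : Integrable (fun x => D x ^ 2) := by
    simp_rw [sq]
    exact (hD.mul hD).integrable_of_hasCompactSupport hc.mul_right
  have hzero : ∫ x, D x ^ 2 = 0 := by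
    refine le_antisymm (le_of_forall_pos_le_add fun ε hε => ?_)
      (integral_nonneg fun x => sq_nonneg _)
    set A := ∫ x, ‖D x‖ with hA
    have hA0 : 0 ≤ A := integral_nonneg fun x => norm_nonneg _
    obtain ⟨p, hpε⟩ := exists_polynomial_near_of_continuousOn (-1) 1 D hD.continuousOn
      (ε / (A + 1)) (by positivity)
    have e1 : ∫ x, D x ^ 2 = ∫ x, (D x ^ 2 - D x * p.eval x) := by
      rw [integral_sub hsq (hint p), hp p, sub_zero]
    rw [e1, zero_add]
    calc ∫ x, (D x ^ 2 - D x * p.eval x) ≤ ∫ x, ‖D x‖ * (ε / (A + 1)) := by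
          refine integral_mono (hsq.sub (hint p)) (hDi.norm.mul_const _) fun x => ?_
          simp only
          by_cases hx : x ∈ Icc (-1 : ℝ) 1
          · calc D x ^ 2 - D x * p.eval x ≤ |D x * (D x - p.eval x)| := by
                  refine le_trans (le_of_eq ?_) (le_abs_self _)
                  ring
              _ = ‖D x‖ * |p.eval x - D x| := by
                  rw [abs_mul, abs_sub_comm, Real.norm_eq_abs]
              _ ≤ _ := mul_le_mul_of_nonneg_left (hpε x hx).le (norm_nonneg _)
          · simp [h0 x hx]
      _ = A * (ε / (A + 1)) := by rw [integral_mul_const]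
      _ ≤ ε := by
          rw [mul_div_assoc', div_le_iff₀ (by positivity)]
          nlinarith
  have hae := (integral_eq_zero_iff_of_nonneg (fun x => sq_nonneg (D x)) hsq).1 hzero
  have := (Continuous.ae_eq_iff_eq volume (hD.pow 2) continuous_zero).1 hae
  funext x
  simpa using congrFun this x

/-- The Green function inverts the half-Laplacian on test functions supported in `(-1,1)`. -/
theorem greenPotential_halfLaplacian {φ : ℝ → ℝ} (hφ : ContDiff ℝ 2 φ)
    (hc : HasCompactSupport φ) (hsub : tsupport φ ⊆ Ioo (-1) 1)
    (hψ : Continuous (halfLaplacian φ)) {M : ℝ} (hM : ∀ x, |halfLaplacian φ x| ≤ M) :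
    greenPotential (halfLaplacian φ) = φ := by
  have hP : Continuous (greenPotential (halfLaplacian φ)) := continuous_greenPotential hψ hM
  have hφ0 : ∀ x ∉ Ioo (-1 : ℝ) 1, φ x = 0 := fun x hx =>
    image_eq_zero_of_notMem_tsupport fun h => hx (hsub h)
  have hPc : HasCompactSupport (greenPotential (halfLaplacian φ)) :=
    HasCompactSupport.intro isCompact_Icc fun x hx =>
      greenPotential_eq_zero _ fun h => hx (Ioo_subset_Icc_self h)
  refine sub_eq_zero.1 (eq_zero_of_forall_integral_mul_U (hP.sub hφ.continuous) (fun x hx => ?_)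
    fun k => ?_)
  · have hx' : x ∉ Ioo (-1 : ℝ) 1 := fun h => hx (Ioo_subset_Icc_self h)
    simp [greenPotential_eq_zero _ hx', hφ0 x hx']
  · have h1 := integral_greenPotential_mul_U hψ k
    rw [integral_sqrt_mul_U_mul_halfLaplacian hφ hc hsub,
      intervalIntegral.integral_of_le (by norm_num),
      setIntegral_eq_integral_of_forall_compl_eq_zero fun z hz => by
        rw [greenPotential_eq_zero _ fun h => hz (Ioo_subset_Ioc_self h), zero_mul]] at h1
    have h2 := mul_left_cancel₀ (by positivity) h1
    simp only [Pi.sub_apply, sub_mul]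
    have i1 : Integrable (fun x => greenPotential (halfLaplacian φ) x * (Chebyshev.U ℝ k).eval x) :=
      (hP.mul (Polynomial.continuous _)).integrable_of_hasCompactSupport hPc.mul_right
    have i2 : Integrable (fun x => φ x * (Chebyshev.U ℝ k).eval x) :=
      (hφ.continuous.mul (Polynomial.continuous _)).integrable_of_hasCompactSupport hc.mul_right
    rw [integral_sub i1 i2, h2, sub_self]

/-! ### Distributions -/

lemma testToSchwartz_apply (Ω : Opens ℝ) (φ : 𝓓(Ω, ℝ)) (x : ℝ) :
    testToSchwartz Ω φ x = (φ x : ℂ) := rfl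

lemma restrictTo_apply (Ω : Opens ℝ) (T : 𝓢'(ℝ, ℂ)) (φ : 𝓓(Ω, ℝ)) :
    restrictTo Ω T φ = T (testToSchwartz Ω φ) := rfl

lemma opI_apply (u : ℝ → ℝ) (Φ : 𝓢(ℝ, ℂ)) :
    opI u Φ = ∫ ξ, (𝓕⁻ Φ) ξ * symbolTimesFourier u ξ := rfl

lemma ofFunction_apply {Ω : Opens ℝ} {f : ℝ → ℝ}
    (hf : LocallyIntegrableOn (fun x => (f x : ℂ)) Ω) (φ : 𝓓(Ω, ℝ)) :
    ofFunction Ω f φ = ∫ x, ((φ x * f x : ℝ) : ℂ) := by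
  have h : ofFunction Ω f φ = ∫ x, ContinuousLinearMap.lsmul ℝ ℝ (φ x) (f x : ℂ) :=
    TestFunction.integralAgainstBilinCLM_eq_integral hf
  rw [h]
  refine integral_congr_ae (Eventually.of_forall fun x => ?_)
  simp

lemma contDiff_testFunction {Ω : Opens ℝ} (φ : 𝓓(Ω, ℝ)) (n : ℕ) : ContDiff ℝ n φ :=
  φ.contDiff.of_le (by exact_mod_cast le_top)

lemma testFunction_deriv_apply {Ω : Opens ℝ} (φ : 𝓓(Ω, ℝ)) (x : ℝ) :
    (∂_{(1 : ℝ)} φ : 𝓓(Ω, ℝ)) x = deriv φ x := by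
  have h1 : (∂_{(1 : ℝ)} φ : 𝓓(Ω, ℝ)) x = lineDeriv ℝ φ x 1 :=
    TestFunction.lineDerivCLM_apply_of_le (𝕜 := ℝ) le_top
  rw [h1, ((contDiff_testFunction φ 1).differentiable (by norm_num) x).lineDeriv_eq_fderiv,
    fderiv_apply_one_eq_deriv]

/-- On integrable functions the operator `I` is the transpose of minus the half-Laplacian. -/
lemma opI_apply_eq {u : ℝ → ℝ} (hu : Integrable u) {φ : ℝ → ℝ} (hφ : ContDiff ℝ 2 φ)
    (hc : HasCompactSupport φ) {Φ : 𝓢(ℝ, ℂ)} (hΦ : ∀ x, Φ x = φ x) :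
    opI u Φ = ((-∫ x, u x * halfLaplacian φ x : ℝ) : ℂ) := by
  have h1 : ∫ ξ, 𝓕 (fun x => (u x : ℂ)) ξ • (((2 * Real.pi * |ξ| : ℝ) : ℂ) * (𝓕⁻ Φ) ξ) =
      ∫ x, (u x : ℂ) • 𝓕 (fun ξ : ℝ => ((2 * Real.pi * |ξ| : ℝ) : ℂ) * (𝓕⁻ Φ) ξ) x := by
    simpa using! VectorFourier.integral_fourierIntegral_smul_eq_flip (L := innerₗ ℝ)
      Real.continuous_fourierChar continuous_inner (hu.ofReal (𝕜 := ℂ))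
      (integrable_abs_mul_schwartz (𝓕⁻ Φ))
  have h2 : ∀ ξ, (𝓕⁻ Φ) ξ * symbolTimesFourier u ξ =
      -(𝓕 (fun x => (u x : ℂ)) ξ • (((2 * Real.pi * |ξ| : ℝ) : ℂ) * (𝓕⁻ Φ) ξ)) := by
    intro ξ
    rw [symbolTimesFourier, smul_eq_mul]
    ring
  rw [opI_apply]
  simp_rw [h2]
  rw [integral_neg, h1, Complex.ofReal_neg, ← integral_complex_ofReal]
  congr 2 with x
  rw [fourier_abs_mul_fourierInv hφ hc Φ hΦ, smul_eq_mul, Complex.ofReal_mul]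

lemma integral_greenPotential_mul {h ψ : ℝ → ℝ} (hh : IsSource h) (hψ : Continuous ψ) {M : ℝ}
    (hM : ∀ x, |ψ x| ≤ M) :
    ∫ x, greenPotential h x * ψ x = ∫ z, h z * greenPotential ψ z := by
  have hi : Integrable (Function.uncurry fun x z : ℝ => ψ x * (greenG x z * h z))
      (volume.prod volume) :=
    hh.integrable_prod.bdd_mul (f := fun p : ℝ × ℝ => ψ p.1) (c := M)
      (hψ.comp continuous_fst).aestronglyMeasurable (Eventually.of_forall fun p => hM p.1)
  calc ∫ x, greenPotential h x * ψ x = ∫ x, ∫ z, ψ x * (greenG x z * h z) := by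
        refine integral_congr_ae (Eventually.of_forall fun x => ?_)
        simp only
        rw [integral_const_mul, greenPotential, mul_comm]
    _ = ∫ z, ∫ x, ψ x * (greenG x z * h z) := integral_integral_swap hi
    _ = ∫ z, h z * greenPotential ψ z := by
        refine integral_congr_ae (Eventually.of_forall fun z => ?_)
        simp only
        rw [greenPotential, ← integral_const_mul]
        congr 1 with x
        rw [greenG_comm z x]
        ring

/-- The potential is not differentiable at `±1`, so the rule for the Fourier transform of a
derivative is obtained from `integral_deriv_mul_potential` with an exponential. -/
lemma fourier_deriv_potential {h : ℝ → ℝ} (hh : IsSource h) (ξ : ℝ) :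
    𝓕 (fun x => ((deriv (potential h) x : ℝ) : ℂ)) ξ =
      (2 * Real.pi * Complex.I * ξ) * 𝓕 (fun x => (potential h x : ℂ)) ξ := by
  have hd : ∀ x : ℝ, HasDerivAt (fun x : ℝ => Complex.exp (-(2 * Real.pi * Complex.I * ξ) * x))
      (-(2 * Real.pi * Complex.I * ξ) * Complex.exp (-(2 * Real.pi * Complex.I * ξ) * x)) x := by
    intro x
    have h1 : HasDerivAt (fun x : ℝ => (x : ℂ)) 1 x := by
      simpa using (hasDerivAt_id x).ofReal_comp
    refine ((h1.const_mul (-(2 * Real.pi * Complex.I * ξ))).cexp).congr_deriv ?_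
    ring
  have h1 := integral_deriv_mul_potential hh hd (by fun_prop)
  have h2 : ∀ w : ℝ → ℝ, 𝓕 (fun x => (w x : ℂ)) ξ =
      ∫ x : ℝ, Complex.exp (-(2 * Real.pi * Complex.I * ξ) * x) * (w x : ℂ) := by
    intro w
    rw [Real.fourier_eq']
    refine integral_congr_ae (Eventually.of_forall fun x => ?_)
    simp only [smul_eq_mul, RCLike.inner_apply, conj_trivial]
    congr 2
    push_cast
    ring
  simp_rw [mul_assoc (-(2 * Real.pi * Complex.I * ξ) : ℂ)] at h1
  rw [integral_const_mul] at h1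
  rw [h2, h2]
  linear_combination h1

/-- The operator `I` commutes with the derivative of the potential. -/
lemma deriv_restrictTo_opI {h : ℝ → ℝ} (hh : IsSource h) (Ω : Opens ℝ) :
    ∂_{(1 : ℝ)} (restrictTo Ω (opI (potential h))) = restrictTo Ω (opI (deriv (potential h))) := by
  ext φ
  rw [Distribution.lineDerivOp_apply_apply, map_neg, restrictTo_apply, restrictTo_apply, opI_apply,
    opI_apply, ← integral_neg]
  have hT : testToSchwartz Ω (∂_{(1 : ℝ)} φ) = ∂_{(1 : ℝ)} (testToSchwartz Ω φ) := by
    ext x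
    have hd := ((contDiff_testFunction φ 1).differentiable (by norm_num) x).hasDerivAt.ofReal_comp
    rw [testToSchwartz_apply, testFunction_deriv_apply, SchwartzMap.lineDerivOp_apply,
      (testToSchwartz Ω φ).differentiableAt.lineDeriv_eq_fderiv, fderiv_apply_one_eq_deriv]
    exact hd.deriv.symm
  have htg : (inner ℝ · (1 : ℝ)).HasTemperateGrowth := by fun_prop
  refine integral_congr_ae (Eventually.of_forall fun ξ => ?_)
  simp only
  rw [hT, SchwartzMap.fourierInv_lineDerivOp_eq, symbolTimesFourier, symbolTimesFourier,
    fourier_deriv_potential hh, _root_.smul_apply, SchwartzMap.smulLeftCLM_apply_apply htg]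
  simp
  ring

lemma locallyIntegrable_ofReal {u : ℝ → ℝ} (hu : Integrable u) (s : Set ℝ) :
    LocallyIntegrableOn (fun x => (u x : ℂ)) s :=
  (hu.ofReal (𝕜 := ℂ)).locallyIntegrable.locallyIntegrableOn s

lemma deriv_ofFunction_potential {h : ℝ → ℝ} (hh : IsSource h) (Ω : Opens ℝ) :
    ∂_{(1 : ℝ)} (ofFunction Ω (potential h)) = ofFunction Ω (deriv (potential h)) := by
  ext φ
  rw [Distribution.lineDerivOp_apply_apply, map_neg,
    ofFunction_apply (locallyIntegrable_ofReal (integrable_potential hh) _),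
    ofFunction_apply (locallyIntegrable_ofReal (integrable_deriv_potential hh) _)]
  have hφ := contDiff_testFunction φ 1
  have h1 := integral_deriv_mul_potential hh
    (fun x => (hφ.differentiable (by norm_num) x).hasDerivAt.ofReal_comp)
    (by have := hφ.continuous_deriv le_rfl; fun_prop)
  simp_rw [testFunction_deriv_apply]
  push_cast
  rw [h1, neg_neg]

/-- The Green potential of `-h` is mapped by `I` to `h` in `(-1,1)`. -/
lemma restrictTo_opI_deriv_potential {h : ℝ → ℝ} (hh : IsSource h) (hodd : ∀ z, h (-z) = -h z) :
    restrictTo interval (opI (deriv (potential h))) = ofFunction interval h := by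
  have hloc : LocallyIntegrableOn (fun x => (h x : ℂ)) interval := by
    refine (locallyIntegrableOn_iff isOpen_Ioo.isLocallyClosed).2 fun K hKs hK => ?_
    obtain ⟨r, hr1, hr⟩ : ∃ r < 1, ∀ z ∈ K, |z| ≤ r := by
      rcases K.eq_empty_or_nonempty with rfl | hne
      · exact ⟨0, by norm_num, by simp⟩
      · obtain ⟨z0, hz0, hmax⟩ := hK.exists_isMaxOn hne continuous_abs.continuousOn
        exact ⟨|z0|, abs_lt.2 (hKs hz0), fun z hz => hmax hz⟩
    obtain ⟨M, hM⟩ := hh.bounded r hr1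
    refine Measure.integrableOn_of_bounded (M := M) hK.measure_lt_top.ne
      (Complex.continuous_ofReal.comp_aestronglyMeasurable hh.aestronglyMeasurable) ?_
    filter_upwards [ae_restrict_mem hK.measurableSet] with z hz
    rw [Complex.norm_real]
    exact hM z (hr z hz)
  ext φ
  have hφ := contDiff_testFunction φ 2
  have hΦ := testToSchwartz_apply interval φ
  obtain ⟨hψ, M, hM⟩ := halfLaplacian_continuous_bounded hφ φ.hasCompactSupport _ hΦ
  rw [restrictTo_apply, ofFunction_apply hloc, integral_complex_ofReal,
    opI_apply_eq (integrable_deriv_potential hh) hφ φ.hasCompactSupport hΦ]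
  congr 1
  have e1 : ∫ x, deriv (potential h) x * halfLaplacian φ x =
      ∫ x, greenPotential (velocityDensity h) x * halfLaplacian φ x := by
    refine integral_congr_ae ?_
    filter_upwards [ae_deriv_potential hh] with x hx
    rw [hx]
  rw [e1, integral_greenPotential_mul hh.velocityDensity hψ hM,
    greenPotential_halfLaplacian hφ φ.hasCompactSupport φ.tsupport_subset hψ hM, ← integral_neg]
  congr 1 with z
  rw [velocityDensity, hodd]
  ring

/-- Test functions on `(-1,1)` do not see the values of `f` elsewhere; this includes the junk value
`0` that `ofFunction` takes when `f` is not locally integrable in `(-1,1)`. -/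
lemma ofFunction_indicator (f : ℝ → ℝ) :
    ofFunction interval ((Ioo (-1 : ℝ) 1).indicator f) = ofFunction interval f := by
  have hiff : LocallyIntegrableOn (fun x => (((Ioo (-1 : ℝ) 1).indicator f x : ℝ) : ℂ))
      (interval : Set ℝ) ↔ LocallyIntegrableOn (fun x => (f x : ℂ)) (interval : Set ℝ) := by
    rw [locallyIntegrableOn_iff interval.isOpen.isLocallyClosed,
      locallyIntegrableOn_iff interval.isOpen.isLocallyClosed]
    refine forall_congr' fun K => forall_congr' fun hKs => forall_congr' fun hK => ?_
    refine integrableOn_congr_fun (fun x hx => ?_) hK.measurableSet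
    rw [indicator_of_mem (show x ∈ Ioo (-1 : ℝ) 1 from hKs hx)]
  ext φ
  by_cases hf : LocallyIntegrableOn (fun x => (f x : ℂ)) (interval : Set ℝ)
  · rw [ofFunction_apply hf, ofFunction_apply (hiff.2 hf)]
    refine integral_congr_ae (Eventually.of_forall fun x => ?_)
    simp only
    by_cases hx : x ∈ Ioo (-1 : ℝ) 1
    · rw [indicator_of_mem hx]
    · rw [image_eq_zero_of_notMem_tsupport (f := φ) fun h => hx (φ.tsupport_subset h), zero_mul,
        zero_mul]
  · have h0 : ∀ g : ℝ → ℝ, ¬ LocallyIntegrableOn (fun x => (g x : ℂ)) (interval : Set ℝ) →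
        ofFunction interval g φ = 0 := fun g hg =>
      congrArg (fun T : 𝓓(interval, ℝ) →L[ℝ] ℂ => T φ)
        (TestFunction.integralAgainstBilinCLM_eq_zero hg)
    rw [h0 f hf, h0 _ (mt hiff.1 hf)]

end HydraulicFracture

end

theorem proposition3p6 (a : ℝ) (ha : -3 / 2 < a) :
    ∃ C : ℝ, 0 < C ∧ ∀ (f : ℝ → ℝ) (Cf : ℝ),
      AEStronglyMeasurable f (volume.restrict (Ioo (-1 : ℝ) 1)) →
      (∀ z ∈ Ioo (-1 : ℝ) 1, |f z| ≤ Cf * (1 - z ^ 2) ^ a) →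
      -- the integral defining `U(x)` converges absolutely
      (∀ x ∈ Ioo (-1 : ℝ) 1,
        IntegrableOn (fun z => HydraulicFracture.greeng x z * f z) (Ioo (-1 : ℝ) 1)) ∧
      Continuous (HydraulicFracture.potential f) ∧
      ContDiffOn ℝ 1 (HydraulicFracture.potential f) (Ioo (-1 : ℝ) 1) ∧
      (∀ x ∈ Ioo (-1 : ℝ) 1, |HydraulicFracture.potential f x| ≤ C * Cf * √(1 - x ^ 2)) ∧
      ((∀ z ∈ Ioo (-1 : ℝ) 1, f (-z) = -f z) →
        -- `U'` is an integrable function on `ℝ`, and it is also the distributional derivative of `U`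
        Integrable (deriv (HydraulicFracture.potential f)) ∧
        ∂_{(1 : ℝ)} (HydraulicFracture.ofFunction ⊤ (HydraulicFracture.potential f)) =
          HydraulicFracture.ofFunction ⊤ (deriv (HydraulicFracture.potential f)) ∧
        -- `I(U)' = f` in `𝓓'(-1,1)`
        ∂_{(1 : ℝ)} (HydraulicFracture.restrictTo HydraulicFracture.interval
            (HydraulicFracture.opI (HydraulicFracture.potential f))) =
          HydraulicFracture.ofFunction HydraulicFracture.interval f ∧
        -- `I(U') = f` in `𝓓'(-1,1)`
        HydraulicFracture.restrictTo HydraulicFracture.interval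
            (HydraulicFracture.opI (deriv (HydraulicFracture.potential f))) =
          HydraulicFracture.ofFunction HydraulicFracture.interval f) := by
  open HydraulicFracture in
  set K : ℝ := Real.pi⁻¹ * ∫ z in Ioo (-1 : ℝ) 1, (1 - z ^ 2) ^ (a + 1 / 2) with hK
  have hK0 : 0 ≤ K := mul_nonneg (by positivity) (setIntegral_nonneg measurableSet_Ioo
    fun z hz => Real.rpow_nonneg (one_sub_sq_pos hz).le _)
  -- the summand `1` only serves to make the constant positive
  refine ⟨K + 1, by positivity, fun f Cf hf hb => ?_⟩
  have hCf : 0 ≤ Cf := by simpa using (abs_nonneg _).trans (hb 0 (by simp))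
  have hh := isSource_indicator ha hf hb
  have hc := continuous_potential hh
  have hC1 := contDiffOn_potential hh
  have hdi := integrable_deriv_potential hh
  have hdist := deriv_ofFunction_potential hh ⊤
  have hcomm := deriv_restrictTo_opI hh interval
  have hI := restrictTo_opI_deriv_potential hh
  rw [ofFunction_indicator] at hI
  rw [potential_indicator] at hc hC1 hdi hdist hcomm hI
  refine ⟨fun x _ => integrableOn_greeng_mul ha hf hb x, hc, hC1, fun x _ => ?_, fun hodd => ?_⟩
  · refine (abs_potential_le ha hb x).trans ?_
    gcongr
    linarith
  · have hodd' : ∀ z, (Ioo (-1 : ℝ) 1).indicator f (-z) = -(Ioo (-1 : ℝ) 1).indicator f z := by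
      intro z
      by_cases hz : z ∈ Ioo (-1 : ℝ) 1
      · rw [indicator_of_mem hz, indicator_of_mem (neg_mem_Ioo_iff.2 hz), hodd z hz]
      · rw [indicator_of_notMem hz, indicator_of_notMem (mt neg_mem_Ioo_iff.1 hz), neg_zero]
    exact ⟨hdi, hdist, hcomm.trans (hI hodd'), hI hodd'⟩
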